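/- **Setting.** Let $K=(V,E,F)$ be a connected triangulated compact surface, with or without boundary, orientable or not: a finite connected regular two-dimensional cell complex whose faces are triangles, in which every edge lies in one or two faces and every node has a connected non-empty link. Orient all cells arbitrarily, let $\iota$ be the incidence numbers, and let $\delta^0,\delta^1$ be the coboundary maps on real cochains. Let $\partial K$ be the subcomplex formed by the edges that lie in exactly one face and by their ends, and let $\partial K^c$ be any subcomplex of $\partial K$. Relative cochains vanish on $\partial K^c$, and $H^1(K,\partial K^c;\mathbb R)=Z^1(K,\partial K^c)/B^1(K,\partial K^c)$. The *holes* are the connected components of $\partial K$; the *contacts* are the connected components of $\partial K\setminus\partial K^c$ (as an open subset of $\partial K$). The dual graph has the faces as nodes, and each interior edge joins the two faces containing it. **Cochain of a dual path.** Given a path of distinct faces $f_1,\dots,f_l$, crossing distinct interior edges $e_1,\dots,e_{l-1}$ in turn, and edges $e_0:=e\subset f_1$, $e_l:=e'\subset f_l$, start with $\mathbf g=\mathbf 0$, put $\mathbf g(e)=1$, and for $i=1,\dots,l$ assign $$\mathbf g(e_i):=-\frac{\iota(f_i,e_i)}{\iota(f_i,e_{i-1})}\,\mathbf g(e_{i-1}).$$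 If the value of $\mathbf g$ on $e$ is still $1$ at the end, return $\mathbf g$; otherwise (possible only if $e'=e$) return $\mathbf 0$. **Algorithm.** All choices below are arbitrary. 1. *Handles.* Choose a spanning tree $T$ of the $1$-skeleton that extends a spanning tree of each hole, and a spanning tree $\tilde T$, on all faces, of the dual graph restricted to interior edges not in $T$. Add to $\tilde T$ the dual of the one edge of each hole that is not in $T$. Let $E_M$ be the set of edges that are not in $T$ and whose duals are not in $\tilde T$. For $e\in E_M$ let $f_e^{(1)},f_e^{(2)}$ be the two faces containing $e$, and let $\mathbf g_e$ be the cochain of the path in $\tilde T$ from $f^{(1)}_e$ to $f^{(2)}_e$ and the pair $(e,e)$. Let $E_M^{\rm II}=\{e\in E_M:\mathbf g_e=\mathbf 0\}$. If $E_M^{\rm II}=\emptyset$, then $\mathcal G^{\rm ha}=\{\mathbf g_e\}_{e\in E_M}$. Otherwise choose $e^*\in E_M^{\rm II}$; for $e\in E_M^{\rm II}\setminus\{e^*\}$ let $\mathbf g_e^{(m)}$ ($m=1,2$) be the cochain of the path in $\tilde T$ from $f_e^{(m)}$ to $f_{e^*}^{(m)}$ and the pair $(e,e^*)$, and redefine $\mathbf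 g_e$ as $\mathbf g_e^{(1)}$ on $\{e,e^*\}$ and as $\mathbf g_e^{(1)}+\mathbf g_e^{(2)}$ on all other edges; then $\mathcal G^{\rm ha}=\{\mathbf g_e\}_{e\in E_M\setminus\{e^*\}}$. 2. *Holes.* If $\partial K\ne\emptyset$, choose one hole; for every other hole $k$ put $\mathbf g^{\rm ho}_k=\delta^0 \mathbf 1_k$, where $\mathbf 1_k$ is $1$ on the nodes of hole $k$ and $0$ on all other nodes. These form $\mathcal G^{\rm ho}$, which is empty if $\partial K=\emptyset$. 3. *Contacts.* If $\partial K^c\neq\partial K$, choose an edge $e_j$ in every contact $j$ and one distinguished contact, whose chosen edge is denoted by $e$. For a boundary edge $x$ let $f_x$ be the face containing it. For every other contact $j$ let $\mathbf g^{\rm co}_j$ be the cochain of the path in $\tilde T$ from $f_{e_j}$ to $f_e$ and the pair $(e_j,e)$. If $E_M^{\rm II}\neq\emptyset$, choose $e^*\in E_M^{\rm II}$ (possibly different from the edge in step 1), let $\mathbf g^{(m)}$ be the cochain of the path in $\tilde T$ from $f_e$ to $f_{e^*}^{(m)}$ and the pair $(e,e^*)$, and add the cochain that equals $\mathbf g^{(1)}$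 on $e^*$ and $\mathbf g^{(1)}+\mathbf g^{(2)}$ on all other edges. These form $\mathcal G^{\rm co}$, which is empty if $\partial K^c=\partial K$. **Statement.** The algorithm can be carried out, and, whatever choices are made: * all returned cochains are relative cocycles in $Z^1(K,\partial K^c;\mathbb R)$; * $H^1(K,\partial K^c;\mathbb R)$ is the internal direct sum of the spans of the classes of the three families, so that $$H^1(K,\partial K^c;\mathbb R)\cong\operatorname{span}[\mathcal G^{\rm ha}]\oplus\operatorname{span}[\mathcal G^{\rm ho}]\oplus\operatorname{span}[\mathcal G^{\rm co}];$$ * the classes of the handle generators are linearly independent, and so are the classes of the contact generators; * the classes of all the returned cochains together form a basis of $H^1(K,\partial K^c;\mathbb R)$ if and only if every hole contains a node of $\partial K^c$ (no contact is a whole component of $\partial K$) or $\partial K$ has at most one component. -/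

import Mathlib

/-- The combinatorial data of a finite regular two-dimensional cell complex all of whose cells are
simplices, with nodes `V`, edges `E` and faces `F`, together with an arbitrary orientation of its
cells. An edge has two distinct end nodes and is oriented from `tail` to `head`; a face has three
distinct corners, is oriented by their cyclic order, and its `i`-th side joins the corners `i` and
`i + 1`. Distinct edges may have the same ends, and distinct faces the same sides. -/
structure Triangulation (V E F : Type*) where
  tail : E → V
  head : E → V
  tail_ne_head : ∀ e, tail e ≠ head e
  corner : F → Fin 3 → V
  corner_injective : ∀ f, Function.Injective (corner f)
  side : F → Fin 3 → E
  side_ends : ∀ f i, s(tail (side f i), head (side f i)) = s(corner f i, corner f (i + 1))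

namespace Triangulation

variable {V E F : Type*} (K : Triangulation V E F)

/-! ### Incidence, boundary, surfaces -/

/-- `v` is an end node of the edge `e`. -/
def IsEnd (v : V) (e : E) : Prop := v = K.tail e ∨ v = K.head e

/-- `e` is a side of the face `f`. -/
def IsSide (e : E) (f : F) : Prop := ∃ i, K.side f i = e

/-- The edges of `∂K`: those incident with exactly one face. -/
def bdryEdges : Set E := {e | {f | K.IsSide e f}.ncard = 1}

/-- The nodes of `∂K`. -/
def bdryNodes : Set V := {v | ∃ e ∈ K.bdryEdges, K.IsEnd v e}

/-- The simple graph on the nodes in which the edges of `S` join their ends. -/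
def edgeGraph (S : Set E) : SimpleGraph V where
  Adj u v := u ≠ v ∧ ∃ e ∈ S, K.IsEnd u e ∧ K.IsEnd v e
  symm := ⟨fun _ _ h => ⟨h.1.symm, let ⟨e, he, hu, hv⟩ := h.2; ⟨e, he, hv, hu⟩⟩⟩
  loopless := ⟨fun _ h => h.1 rfl⟩

/-- The simple graph on the faces (the dual nodes) in which the duals of the edges in `S` join the
two faces incident with the edge. -/
def dualEdgeGraph (S : Set E) : SimpleGraph F where
  Adj f f' := f ≠ f' ∧ ∃ e ∈ S, K.IsSide e f ∧ K.IsSide e f'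
  symm := ⟨fun _ _ h => ⟨h.1.symm, let ⟨e, he, hu, hv⟩ := h.2; ⟨e, he, hv, hu⟩⟩⟩
  loopless := ⟨fun _ h => h.1 rfl⟩

/-- The link of the node `v`: its nodes are the edges at `v`, and two of them are joined when they
are sides of a common face. -/
def link (v : V) : SimpleGraph {e : E // K.IsEnd v e} where
  Adj a b := a ≠ b ∧ ∃ f, K.IsSide a.1 f ∧ K.IsSide b.1 f
  symm := ⟨fun _ _ h => ⟨h.1.symm, let ⟨f, hu, hv⟩ := h.2; ⟨f, hv, hu⟩⟩⟩
  loopless := ⟨fun _ h => h.1 rfl⟩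

/-- `K` triangulates a connected compact surface, with or without boundary: it is connected, each
edge lies in one or two faces, and each node has a connected (non-empty) link. By the second
condition a connected link is a path or a cycle. -/
structure IsConnectedSurface : Prop where
  connected : (K.edgeGraph Set.univ).Connected
  one_or_two : ∀ e, {f | K.IsSide e f}.ncard = 1 ∨ {f | K.IsSide e f}.ncard = 2
  link_connected : ∀ v, (K.link v).Connected

/-- A subcomplex of the boundary `∂K`. -/
structure BdrySubcomplex where
  nodes : Set V
  edges : Set E
  nodes_subset : nodes ⊆ K.bdryNodes
  edges_subset : edges ⊆ K.bdryEdges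
  closed : ∀ e ∈ edges, ∀ v, K.IsEnd v e → v ∈ nodes

/-! ### Real cochains and relative cohomology in degree one -/

open Classical in
/-- The incidence number of an edge and a node. -/
noncomputable def inc₁ (e : E) (v : V) : ℤ :=
  (if v = K.head e then 1 else 0) - (if v = K.tail e then 1 else 0)

open Classical in
/-- The incidence number of a face and an edge: `1` or `-1` when `e` is a side of `f`, according to
whether `e` is oriented along the cyclic order of the corners of `f`, and `0` otherwise. -/
noncomputable def inc₂ (f : F) (e : E) : ℤ :=
  ∑ i : Fin 3, if K.side f i = e then (if K.tail e = K.corner f i then 1 else -1) else 0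

/-- The coboundary map from `0`-cochains to `1`-cochains. -/
noncomputable def δ₀ [Fintype V] : (V → ℝ) →ₗ[ℝ] (E → ℝ) where
  toFun c e := ∑ v, (K.inc₁ e v : ℝ) * c v
  map_add' c d := by
    funext e
    simp [mul_add, Finset.sum_add_distrib]
  map_smul' a c := by
    funext e
    simp only [Pi.smul_apply, smul_eq_mul, RingHom.id_apply, Finset.mul_sum]
    exact Finset.sum_congr rfl fun v _ => by ring

/-- The coboundary map from `1`-cochains to `2`-cochains. -/
noncomputable def δ₁ [Fintype E] : (E → ℝ) →ₗ[ℝ] (F → ℝ) where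
  toFun g f := ∑ e, (K.inc₂ f e : ℝ) * g e
  map_add' c d := by
    funext e
    simp [mul_add, Finset.sum_add_distrib]
  map_smul' a c := by
    funext e
    simp only [Pi.smul_apply, smul_eq_mul, RingHom.id_apply, Finset.mul_sum]
    exact Finset.sum_congr rfl fun v _ => by ring

/-- The relative cochains: those vanishing on a set of cells. -/
def vanishingOn {X : Type*} (S : Set X) : Submodule ℝ (X → ℝ) where
  carrier := {c | ∀ x ∈ S, c x = 0}
  add_mem' ha hb x hx := by simp [ha x hx, hb x hx]
  zero_mem' _ _ := rfl
  smul_mem' a c hc x hx := by simp [hc x hx]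

variable {K}

/-- The relative cocycles `Z¹(K, A; ℝ)`. -/
noncomputable def Z1 [Fintype E] (A : K.BdrySubcomplex) : Submodule ℝ (E → ℝ) :=
  vanishingOn A.edges ⊓ LinearMap.ker K.δ₁

/-- The relative coboundaries `B¹(K, A; ℝ)`. -/
noncomputable def B1 [Fintype V] (A : K.BdrySubcomplex) : Submodule ℝ (E → ℝ) :=
  (vanishingOn A.nodes).map K.δ₀

/-- The relative cohomology `H¹(K, A; ℝ) = Z¹(K, A; ℝ) / B¹(K, A; ℝ)`. -/
abbrev H1 [Fintype V] [Fintype E] (A : K.BdrySubcomplex) : Type _ :=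
  Z1 A ⧸ (B1 A).submoduleOf (Z1 A)

/-- The cohomology class of a relative cocycle. -/
noncomputable def cls [Fintype V] [Fintype E] (A : K.BdrySubcomplex) (g : E → ℝ) (hg : g ∈ Z1 A) :
    H1 A :=
  ((B1 A).submoduleOf (Z1 A)).mkQ ⟨g, hg⟩

/-- The span of the cohomology classes of a family of relative cocycles. -/
noncomputable def clsSpan [Fintype V] [Fintype E] (A : K.BdrySubcomplex) {I : Type*}
    (g : I → E → ℝ) (hg : ∀ i, g i ∈ Z1 A) : Submodule ℝ (H1 A) :=
  Submodule.span ℝ (Set.range fun i => cls A (g i) (hg i))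

/-! ### Connected components of `∂K` and of `∂K ∖ A` -/

variable (K) in
/-- The connected components of the boundary `∂K`. -/
abbrev Hole : Type _ := ((K.edgeGraph K.bdryEdges).induce K.bdryNodes).ConnectedComponent

/-- `v` is a node of the boundary component `k`. -/
def Hole.HasNode (k : K.Hole) (v : V) : Prop :=
  ∃ hv : v ∈ K.bdryNodes, SimpleGraph.connectedComponentMk _ (⟨v, hv⟩ : K.bdryNodes) = k

/-- The graph on the edges of `∂K ∖ A` in which two edges are joined when they share a node that is
not in `A`. -/
def contactGraph (A : K.BdrySubcomplex) : SimpleGraph {e : E // e ∈ K.bdryEdges ∧ e ∉ A.edges} where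
  Adj a b := a ≠ b ∧ ∃ v, v ∉ A.nodes ∧ K.IsEnd v a.1 ∧ K.IsEnd v b.1
  symm := ⟨fun _ _ h => ⟨h.1.symm, let ⟨v, h0, hu, hv⟩ := h.2; ⟨v, h0, hv, hu⟩⟩⟩
  loopless := ⟨fun _ h => h.1 rfl⟩

/-- The connected components of `∂K ∖ A`. As `∂K ∖ A` is open in `∂K`, each component contains an
edge, and two edges are in the same component if and only if they are connected through nodes
of `∂K ∖ A`. -/
abbrev Contact (A : K.BdrySubcomplex) : Type _ := (contactGraph A).ConnectedComponent

/-! ### From dual paths to cochains -/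

variable (K) in
/-- `p = [(e₁, f₂), …, (e_{l-1}, f_l)]` lists the steps of a walk in the dual graph that starts at
the face `f`, ends at the face `f'`, and crosses only edges in `S`. -/
def IsDualWalk (S : Set E) : F → List (E × F) → F → Prop
  | f, [], f' => f = f'
  | f, (x, f₂) :: p, f' =>
      (x ∈ S ∧ f ≠ f₂ ∧ K.IsSide x f ∧ K.IsSide x f₂) ∧ IsDualWalk S f₂ p f'

variable (K) in
/-- A dual path: a dual walk with distinct faces and distinct edges. -/
def IsDualPath (S : Set E) (f : F) (p : List (E × F)) (f' : F) : Prop :=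
  K.IsDualWalk S f p f' ∧ (f :: p.map Prod.snd).Nodup ∧ (p.map Prod.fst).Nodup

open Classical in
variable (K) in
/-- The assignment `g b := -(ι(f, b) / ι(f, a)) * g a`. -/
noncomputable def cross (f : F) (a b : E) (g : E → ℝ) : E → ℝ :=
  Function.update g b (-((K.inc₂ f b : ℝ) / (K.inc₂ f a : ℝ)) * g a)

variable (K) in
/-- The loop of assignments along the dual path `f, p`: enter the first face through the edge `a`,
and leave the last face through `e'`. -/
noncomputable def transport (e' : E) : E → F → List (E × F) → (E → ℝ) → (E → ℝ)
  | a, f, [], g => K.cross f a e' g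
  | a, f, (x, f₂) :: p, g => transport e' x f₂ p (K.cross f a x g)

open Classical in
variable (K) in
/-- The cochain built from the dual path `f, p` and the pair `(e, e')`: start with the value `1` on
`e` and `0` elsewhere and assign values along the path, up to and including `e'`. The result is `0`
when the value assigned last overwrites the initial value `1` on `e` by another one (which can
happen only for `e' = e`). -/
noncomputable def pathCochain (e e' : E) (f : F) (p : List (E × F)) : E → ℝ :=
  let g := K.transport e' e f p (Function.update 0 e 1)
  if g e = 1 then g else 0

/-! ### The algorithm

The structures `Trees` and `Choices` record the choices made in a run of the algorithm. -/

variable (K) in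
/-- The trees built in a run, a numbering of the faces at each edge, and the paths in the dual
tree. -/
structure Trees where
  /-- The edges of the spanning tree `T` of the `1`-skeleton. -/
  treeEdges : Set E
  /-- `T` is a spanning tree: it has no parallel edges and its underlying simple graph is a tree. -/
  tree_ends_inj : Set.InjOn (fun e => s(K.tail e, K.head e)) treeEdges
  tree_isTree : (K.edgeGraph treeEdges).IsTree
  /-- `T` extends a spanning tree of each component of `∂K`. -/
  tree_bdry : ∀ u v, (K.edgeGraph K.bdryEdges).Reachable u v →
    (K.edgeGraph (treeEdges ∩ K.bdryEdges)).Reachable u v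
  /-- The interior edges whose duals form the dual spanning tree, on all the faces. -/
  dualTreeEdges : Set E
  /-- The dual tree uses only duals of edges not in `T`. -/
  dual_subset : dualTreeEdges ⊆ (treeEdges ∪ K.bdryEdges)ᶜ
  /-- The dual tree is a spanning tree: it has no parallel edges and its underlying simple graph is
  a tree. -/
  dual_faces_inj : Set.InjOn (fun e => {f | K.IsSide e f}) dualTreeEdges
  dual_isTree : (K.dualEdgeGraph dualTreeEdges).IsTree
  /-- The first face at an edge; for an edge of `∂K` this is the only one. -/
  face₁ : E → F
  /-- The second face at an edge that is not in `∂K`. -/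
  face₂ : E → F
  face₁_side : ∀ e, K.IsSide e (face₁ e)
  face₂_side : ∀ e, K.IsSide e (face₂ e)
  face_ne : ∀ e, e ∉ K.bdryEdges → face₁ e ≠ face₂ e
  /-- The path in the dual tree from one face to another. -/
  path : F → F → List (E × F)
  path_isPath : ∀ f f', K.IsDualPath dualTreeEdges f (path f f') f'

namespace Trees

variable (t : K.Trees)

/-- The edges of the dual tree after the dual of the edge of each component of `∂K` that is not in
`T` has been added. -/
def dualTreeEdges' : Set E := t.dualTreeEdges ∪ {e | e ∈ K.bdryEdges ∧ e ∉ t.treeEdges}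

/-- The edges that are not in the tree and whose duals are not in the dual tree. -/
def EM : Set E := {e | e ∉ t.treeEdges ∧ e ∉ t.dualTreeEdges'}

/-- The cochain of the pair `(e, e')` and the dual tree path from `f` to `f'`. -/
noncomputable def cochain (e e' : E) (f f' : F) : E → ℝ := K.pathCochain e e' f (t.path f f')

/-- The cochain of the closed dual path through `e`. -/
noncomputable def loopCochain (e : E) : E → ℝ := t.cochain e e (t.face₁ e) (t.face₂ e)

/-- The edges of `EM` whose loop cochain is zero. -/
def EMII : Set E := {e | e ∈ t.EM ∧ t.loopCochain e = 0}

open Classical in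
/-- The handle cochain of an edge `e` of `EMII`, relative to the selected edge `s` of `EMII`. -/
noncomputable def twistedCochain (e s : E) : E → ℝ := fun x =>
  if x = e ∨ x = s then t.cochain e s (t.face₁ e) (t.face₁ s) x
  else t.cochain e s (t.face₁ e) (t.face₁ s) x + t.cochain e s (t.face₂ e) (t.face₂ s) x

open Classical in
/-- The additional contact cochain, for an edge `e` of `∂K` and an edge `s` of `EMII`. -/
noncomputable def extraCochain (e s : E) : E → ℝ := fun x =>
  if x = s then t.cochain e s (t.face₁ e) (t.face₁ s) x
  else t.cochain e s (t.face₁ e) (t.face₁ s) x + t.cochain e s (t.face₁ e) (t.face₂ s) x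

end Trees

/-- All the choices made in a run of the algorithm. -/
structure Choices (A : K.BdrySubcomplex) extends K.Trees where
  /-- The edge of `EMII` selected in the construction of the handle generators. -/
  star : toTrees.EMII.Nonempty → E
  star_mem : ∀ h, star h ∈ toTrees.EMII
  /-- The edge of `EMII` selected in the construction of the contact generators. -/
  star' : toTrees.EMII.Nonempty → E
  star'_mem : ∀ h, star' h ∈ toTrees.EMII
  /-- The component of `∂K` that is left out, if there is one. -/
  lastHole : Nonempty K.Hole → K.Hole
  /-- The distinguished component of `∂K ∖ A`, if there is one. -/
  lastContact : Nonempty (Contact A) → Contact A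
  /-- The edge selected in each component of `∂K ∖ A`. -/
  contactEdge : Contact A → {e : E // e ∈ K.bdryEdges ∧ e ∉ A.edges}
  contactEdge_mem : ∀ j, (contactGraph A).connectedComponentMk (contactEdge j) = j

namespace Choices

variable {A : K.BdrySubcomplex} (c : Choices A)

/-- The handle generators are indexed by `EM`, without the selected edge of `EMII` if there is
one. -/
abbrev HaIndex : Type _ := {e : E // e ∈ c.EM ∧ ∀ h : c.EMII.Nonempty, e ≠ c.star h}

open Classical in
/-- The handle generators. -/
noncomputable def ha (e : c.HaIndex) : E → ℝ :=
  if h : e.1 ∈ c.EMII then c.twistedCochain e.1 (c.star ⟨e.1, h⟩) else c.loopCochain e.1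

/-- The hole generators are indexed by the components of `∂K` except the one left out. -/
abbrev HoIndex : Type _ := {k : K.Hole // k ≠ c.lastHole ⟨k⟩}

open Classical in
/-- The hole generators. -/
noncomputable def ho [Fintype V] (k : c.HoIndex) : E → ℝ :=
  K.δ₀ fun v => if k.1.HasNode v then 1 else 0

/-- The contact generators are indexed by the components of `∂K ∖ A`, without the distinguished
one if `EMII` is empty. -/
abbrev CoIndex : Type _ := {j : Contact A // c.EMII.Nonempty ∨ j ≠ c.lastContact ⟨j⟩}

open Classical in
/-- The contact generators. -/
noncomputable def co (j : c.CoIndex) : E → ℝ :=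
  if h : j.1 ≠ c.lastContact ⟨j.1⟩ then
    c.cochain (c.contactEdge j.1).1 (c.contactEdge (c.lastContact ⟨j.1⟩)).1
      (c.face₁ (c.contactEdge j.1).1) (c.face₁ (c.contactEdge (c.lastContact ⟨j.1⟩)).1)
  else
    c.extraCochain (c.contactEdge (c.lastContact ⟨j.1⟩)).1 (c.star' (j.2.resolve_right h))

/-- The family of all the cochains returned by the algorithm. -/
noncomputable def all [Fintype V] : c.HaIndex ⊕ c.HoIndex ⊕ c.CoIndex → E → ℝ :=
  Sum.elim c.ha (Sum.elim c.ho c.co)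

end Choices

end Triangulation

namespace Triangulation

variable {V E F : Type*} {K : Triangulation V E F}

/-! ### Sides of faces and incidence numbers -/

/-! Reorient the faces by signs that are coherent across every dual tree edge
(`Trees.exists_isCoherent`). The value of a cochain on an edge then acts as a current entering the
adjacent faces. The cochain of a dual tree path carries a constant current from its first face to
its last (`IsCoherent.transport_spec`), so the cocycle condition reduces to matching currents at the
two ends. An edge of `EM` closes its own loop exactly when the orientation is coherent across it.
The remaining ones form `EMII` (`Trees.mem_EMII_iff`): such an edge feeds its two faces with the
same sign, and so must be paired with another such edge or with a boundary edge.

Adding all signed face equations gives one linear relation on cocycles in which dual tree edges have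
weight zero (`sum_sum_eps_mul`). This relation accounts for the generator that is left out. If
`EMII` is non-empty, it determines the value on the selected edge of `EMII`. Otherwise every
interior edge has weight zero, and it determines the value on the distinguished contact edge.

Generation is successive subtraction. A relative coboundary clears all boundary edges but one per
contact (`IsConnectedSurface.exists_eq_δ₀_on_bdry`), and the contact generators together with the
relation clear the rest. A cocycle that vanishes on the boundary agrees on the spanning tree with
the coboundary of a function constant on each hole, which is a relative coboundary plus hole
generators. Handle generators then leave a cocycle supported on the dual tree, which is zero
(`Trees.eq_zero_of_support_dual`).

For independence, suppose a combination is a relative coboundary. Boundary edges see only its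
contact part, whose coefficients vanish by a parity argument on the boundary circles
(`IsConnectedSurface.eq_ends_of_contact`). Tree edges then force the potential to be a combination
of hole indicators plus a constant, so the handle coefficients vanish too. Only hole coefficients
can survive, and they do exactly when that potential can vanish on the nodes of `A` without being
trivial; this is the criterion for a basis. -/

theorem isEnd_tail (e : E) : K.IsEnd (K.tail e) e := Or.inl rfl

theorem isEnd_head (e : E) : K.IsEnd (K.head e) e := Or.inr rfl

theorem isEnd_iff_mem (v : V) (e : E) : K.IsEnd v e ↔ v ∈ s(K.tail e, K.head e) := by
  simp [IsEnd]

theorem isSide_side (f : F) (i : Fin 3) : K.IsSide (K.side f i) f := ⟨i, rfl⟩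

theorem isEnd_side_iff (v : V) (f : F) (i : Fin 3) :
    K.IsEnd v (K.side f i) ↔ v = K.corner f i ∨ v = K.corner f (i + 1) := by
  rw [isEnd_iff_mem, K.side_ends, Sym2.mem_iff]

theorem side_orientation (f : F) (i : Fin 3) :
    (K.tail (K.side f i) = K.corner f i ∧ K.head (K.side f i) = K.corner f (i + 1)) ∨
    (K.tail (K.side f i) = K.corner f (i + 1) ∧ K.head (K.side f i) = K.corner f i) := by
  simpa using K.side_ends f i

theorem isEnd_corner_side_iff (f : F) (i j : Fin 3) :
    K.IsEnd (K.corner f j) (K.side f i) ↔ j = i ∨ j = i + 1 := by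
  rw [isEnd_side_iff, (K.corner_injective f).eq_iff, (K.corner_injective f).eq_iff]

/-- Distinct edges may be parallel in general, but not within one face: a side determines which
corners are its ends, and the pair `{i, i + 1}` in `Fin 3` determines `i`. -/
theorem side_injective (f : F) : Function.Injective (K.side f) := by
  intro i j h
  have key : ∀ k, (k = i ∨ k = i + 1) ↔ (k = j ∨ k = j + 1) := fun k => by
    rw [← isEnd_corner_side_iff (K := K) f, ← isEnd_corner_side_iff (K := K) f, h]
  clear h
  revert key
  decide +revert

theorem inc₂_side (f : F) (i : Fin 3) :
    K.inc₂ f (K.side f i) = 1 ∧ K.tail (K.side f i) = K.corner f i ∧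
        K.head (K.side f i) = K.corner f (i + 1) ∨
      K.inc₂ f (K.side f i) = -1 ∧ K.tail (K.side f i) = K.corner f (i + 1) ∧
        K.head (K.side f i) = K.corner f i := by
  classical
  have h : K.inc₂ f (K.side f i) = if K.tail (K.side f i) = K.corner f i then 1 else -1 := by
    simp [inc₂, (side_injective f).eq_iff]
  have hne : K.corner f i ≠ K.corner f (i + 1) := by
    rw [(K.corner_injective f).ne_iff]; clear h; decide +revert
  rcases side_orientation (K := K) f i with h' | h'
  · exact Or.inl ⟨by rw [h, if_pos h'.1], h'⟩
  · exact Or.inr ⟨by rw [h, if_neg (by rw [h'.1]; exact hne.symm)], h'⟩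

theorem inc₂_eq_zero {f : F} {e : E} (h : ¬ K.IsSide e f) : K.inc₂ f e = 0 :=
  Finset.sum_eq_zero fun i _ => if_neg fun hi => h ⟨i, hi⟩

theorem inc₂_eq_one_or {f : F} {e : E} (h : K.IsSide e f) : K.inc₂ f e = 1 ∨ K.inc₂ f e = -1 := by
  obtain ⟨i, rfl⟩ := h
  exact (inc₂_side f i).imp And.left And.left

theorem δ₀_apply [Fintype V] (c : V → ℝ) (e : E) : K.δ₀ c e = c (K.head e) - c (K.tail e) := by
  classical
  simp [δ₀, inc₁, sub_mul, Finset.sum_sub_distrib]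

theorem δ₁_apply [Fintype E] (g : E → ℝ) (f : F) : K.δ₁ g f = ∑ e, (K.inc₂ f e : ℝ) * g e := rfl

theorem sum_eq_sum_sides [Fintype E] {M : Type*} [AddCommMonoid M] (f : F) (q : E → M)
    (hq : ∀ e, ¬ K.IsSide e f → q e = 0) : ∑ e, q e = ∑ i, q (K.side f i) := by
  classical
  rw [← Finset.sum_image (f := q) (s := Finset.univ) (g := K.side f)
    fun i _ j _ h => side_injective f h]
  refine (Finset.sum_subset (Finset.subset_univ _) fun e _ he => hq e ?_).symm
  rintro ⟨i, rfl⟩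
  exact he (Finset.mem_image_of_mem _ (Finset.mem_univ i))

/-- The incidence number cancels the orientation of each side, leaving the increment of `c` from one
corner to the next; these telescope around the face. -/
theorem δ₁_δ₀ [Fintype V] [Fintype E] (c : V → ℝ) : K.δ₁ (K.δ₀ c) = 0 := by
  funext f
  rw [δ₁_apply, sum_eq_sum_sides (K := K) f _ fun e he => by simp [inc₂_eq_zero he]]
  have h : ∀ i, (K.inc₂ f (K.side f i) : ℝ) * K.δ₀ c (K.side f i) =
      c (K.corner f (i + 1)) - c (K.corner f i) := fun i => by
    rw [δ₀_apply]
    rcases inc₂_side (K := K) f i with ⟨h1, h2, h3⟩ | ⟨h1, h2, h3⟩ <;> rw [h1, h2, h3] <;>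
      push_cast <;> ring
  simp only [h, Fin.sum_univ_three, Fin.isValue, Fin.reduceAdd]
  ring_nf
  simp

/-- Every face has an even number of sides that join a node set to its complement. -/
theorem sum_side_indicator [Fintype E] (q : V → ZMod 2) (f : F) :
    ∑ i, (q (K.tail (K.side f i)) + q (K.head (K.side f i))) = 0 := by
  have h : ∀ i, q (K.tail (K.side f i)) + q (K.head (K.side f i)) =
      q (K.corner f i) + q (K.corner f (i + 1)) := fun i => by
    rcases side_orientation (K := K) f i with ⟨h1, h2⟩ | ⟨h1, h2⟩ <;> rw [h1, h2]
    rw [add_comm]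
  simp only [h, Fin.sum_univ_three, Fin.isValue, Fin.reduceAdd]
  have h3 : ∀ a b c : ZMod 2, a + b + (b + c) + (c + a) = 0 := by decide
  exact h3 _ _ _

/-! ### The faces at an edge -/

theorem eq_of_isSide_of_mem_bdryEdges {e : E} (he : e ∈ K.bdryEdges) {f f' : F}
    (h : K.IsSide e f) (h' : K.IsSide e f') : f = f' := by
  obtain ⟨a, ha⟩ := Set.ncard_eq_one.1 he
  have h1 : f ∈ ({a} : Set F) := ha ▸ h
  have h2 : f' ∈ ({a} : Set F) := ha ▸ h'
  exact h1.trans h2.symm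

namespace IsConnectedSurface

theorem exists_isSide (hK : K.IsConnectedSurface) (e : E) : ∃ f, K.IsSide e f := by
  have : {f | K.IsSide e f}.ncard ≠ 0 := by rcases hK.one_or_two e with h | h <;> omega
  exact Set.nonempty_of_ncard_ne_zero this

theorem ncard_eq_two (hK : K.IsConnectedSurface) {e : E} (he : e ∉ K.bdryEdges) :
    {f | K.IsSide e f}.ncard = 2 :=
  (hK.one_or_two e).resolve_left he

theorem eq_or_eq_of_isSide (hK : K.IsConnectedSurface) {e : E} {f f' h : F} (hf : K.IsSide e f)
    (hf' : K.IsSide e f') (hne : f ≠ f') (hh : K.IsSide e h) : h = f ∨ h = f' := by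
  have he : e ∉ K.bdryEdges := fun he => hne (eq_of_isSide_of_mem_bdryEdges he hf hf')
  obtain ⟨a, b, hab, hs⟩ := Set.ncard_eq_two.1 (hK.ncard_eq_two he)
  have h1 : f ∈ ({a, b} : Set F) := hs ▸ hf
  have h2 : f' ∈ ({a, b} : Set F) := hs ▸ hf'
  have h3 : h ∈ ({a, b} : Set F) := hs ▸ hh
  simp only [Set.mem_insert_iff, Set.mem_singleton_iff] at h1 h2 h3
  grind

theorem exists_faces (hK : K.IsConnectedSurface) (e : E) : ∃ f f', K.IsSide e f ∧ K.IsSide e f' ∧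
    (e ∉ K.bdryEdges → f ≠ f') := by
  by_cases he : e ∈ K.bdryEdges
  · obtain ⟨f, hf⟩ := hK.exists_isSide e
    exact ⟨f, f, hf, hf, fun h => (h he).elim⟩
  · obtain ⟨a, b, hab, hs⟩ := Set.ncard_eq_two.1 (hK.ncard_eq_two he)
    have h1 : a ∈ {f | K.IsSide e f} := by rw [hs]; simp
    have h2 : b ∈ {f | K.IsSide e f} := by rw [hs]; simp
    exact ⟨a, b, h1, h2, fun _ => hab⟩

/-- A sum over the faces at an interior edge has two terms. -/
theorem sum_faces_interior (hK : K.IsConnectedSurface) [Fintype F] {M : Type*}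
    [AddCommMonoid M] {e : E} {f f' : F} (hf : K.IsSide e f) (hf' : K.IsSide e f')
    (hne : f ≠ f') (q : F → M) (hq : ∀ h, ¬ K.IsSide e h → q h = 0) : ∑ h, q h = q f + q f' := by
  classical
  rw [← Finset.sum_pair hne]
  refine (Finset.sum_subset (Finset.subset_univ _) fun h _ hh => hq h fun hs => hh ?_).symm
  simpa using hK.eq_or_eq_of_isSide hf hf' hne hs

end IsConnectedSurface

/-- A sum over the faces at a boundary edge has one term. -/
theorem sum_faces_bdry [Fintype F] {M : Type*} [AddCommMonoid M] {e : E} (he : e ∈ K.bdryEdges)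
    {f : F} (hf : K.IsSide e f) (q : F → M)
    (hq : ∀ h, ¬ K.IsSide e h → q h = 0) : ∑ h, q h = q f :=
  Finset.sum_eq_single f (fun h _ hh => hq h fun hs => hh (eq_of_isSide_of_mem_bdryEdges he hs hf))
    (by simp)

/-! ### The boundary is a one-dimensional manifold -/

/-- The sides of a face at one of its corners. -/
theorem isEnd_corner_isSide_iff (f : F) (i : Fin 3) (e : E) :
    (K.IsEnd (K.corner f i) e ∧ K.IsSide e f) ↔ e = K.side f i ∨ e = K.side f (i + 2) := by
  have key : ∀ i j : Fin 3, (i = j ∨ i = j + 1) ↔ (j = i ∨ j = i + 2) := by decide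
  constructor
  · rintro ⟨h, j, rfl⟩
    rw [isEnd_corner_side_iff, key] at h
    rcases h with rfl | rfl <;> simp
  · have h1 : ∀ j, i = j ∨ i = j + 1 → K.IsEnd (K.corner f i) (K.side f j) ∧
        K.IsSide (K.side f j) f := fun j h => ⟨(isEnd_corner_side_iff f j i).2 h, isSide_side f j⟩
    rintro (rfl | rfl)
    · exact h1 _ (Or.inl rfl)
    · exact h1 _ ((key _ _).2 (Or.inr rfl))

theorem exists_corner_of_isSide {v : V} {e : E} {f : F} (hv : K.IsEnd v e) (h : K.IsSide e f) :
    ∃ i, K.corner f i = v := by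
  obtain ⟨j, rfl⟩ := h
  rcases (isEnd_side_iff v f j).1 hv with h | h
  · exact ⟨j, h.symm⟩
  · exact ⟨j + 1, h.symm⟩

theorem ncard_eq_card_filter {X : Type*} [Fintype X] (p : X → Prop) [DecidablePred p] :
    {x | p x}.ncard = (Finset.univ.filter p).card := by
  rw [← Set.ncard_coe_finset, Finset.coe_filter]
  simp

/-- A face with a corner at `v` has exactly two sides there, hence contributes at most one edge to
the link. Only an inequality holds in general, because two faces may share both of these sides. -/
theorem ncard_link_edgeSet_le [Finite F] (v : V) :
    (K.link v).edgeSet.ncard ≤ {f | ∃ i, K.corner f i = v}.ncard := by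
  classical
  choose i hi using fun f : {f | ∃ i, K.corner f i = v} => f.2
  let φ : {f | ∃ i, K.corner f i = v} → Sym2 {e : E // K.IsEnd v e} := fun f =>
    s(⟨K.side f.1 (i f), by
        have := ((isEnd_corner_isSide_iff (K := K) f.1 (i f) _).2 (Or.inl rfl)).1
        rwa [hi] at this⟩,
      ⟨K.side f.1 (i f + 2), by
        have := ((isEnd_corner_isSide_iff (K := K) f.1 (i f) _).2 (Or.inr rfl)).1
        rwa [hi] at this⟩)
  have hsub : (K.link v).edgeSet ⊆ Set.range φ := by
    intro p
    induction p with
    | h a b =>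
      rintro ⟨hab, f, ha, hb⟩
      refine ⟨⟨f, exists_corner_of_isSide a.2 ha⟩, ?_⟩
      -- The chosen corner `i` depends on the bundled face, so the bundle is made a variable before
      -- `f` is replaced.
      generalize hx : (⟨f, exists_corner_of_isSide a.2 ha⟩ :
        {f | ∃ i, K.corner f i = v}) = x
      obtain rfl : x.1 = f := by rw [← hx]
      have h1 := (isEnd_corner_isSide_iff x.1 (i x) a.1).1 ⟨by rw [hi]; exact a.2, ha⟩
      have h2 := (isEnd_corner_isSide_iff x.1 (i x) b.1).1 ⟨by rw [hi]; exact b.2, hb⟩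
      have hab' : a.1 ≠ b.1 := fun h => hab (Subtype.ext h)
      rw [Sym2.eq_iff, Subtype.ext_iff, Subtype.ext_iff, Subtype.ext_iff, Subtype.ext_iff]
      grind
  calc (K.link v).edgeSet.ncard ≤ (Set.range φ).ncard := Set.ncard_le_ncard hsub
    _ ≤ _ := by
      rw [← Set.image_univ]
      exact (Set.ncard_image_le).trans (by rw [Set.ncard_univ]; rfl)

/-- Double counting of pairs of an edge at `v` and a face containing it: an edge has two faces, or
one on the boundary, and a face with a corner at `v` has two sides there. -/
theorem IsConnectedSurface.two_mul_card_edges_at [Fintype E] [Fintype F]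
    (hK : K.IsConnectedSurface) (v : V) :
    2 * {e | K.IsEnd v e}.ncard =
      2 * {f | ∃ i, K.corner f i = v}.ncard + {e | e ∈ K.bdryEdges ∧ K.IsEnd v e}.ncard := by
  classical
  have h := Finset.sum_card_bipartiteAbove_eq_sum_card_bipartiteBelow
    (s := (Finset.univ.filter fun e => K.IsEnd v e))
    (t := (Finset.univ.filter fun f => ∃ i, K.corner f i = v)) (fun e f => K.IsSide e f)
  have h1 : ∀ e ∈ Finset.univ.filter (fun e => K.IsEnd v e),
      (Finset.bipartiteAbove (fun e f => K.IsSide e f)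
        (Finset.univ.filter fun f => ∃ i, K.corner f i = v) e).card +
        (if e ∈ K.bdryEdges then 1 else 0) = 2 := by
    intro e he
    have hev : K.IsEnd v e := by simpa using he
    have : (Finset.bipartiteAbove (fun e f => K.IsSide e f)
        (Finset.univ.filter fun f => ∃ i, K.corner f i = v) e).card =
        {f | K.IsSide e f}.ncard := by
      rw [ncard_eq_card_filter]
      congr 1
      ext f
      simp only [Finset.bipartiteAbove, Finset.mem_filter, Finset.mem_univ, true_and,
        and_iff_right_iff_imp]
      exact fun h => exists_corner_of_isSide hev h
    rw [this]
    by_cases hb : e ∈ K.bdryEdges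
    · rw [if_pos hb, show _ = 1 from hb]
    · rw [if_neg hb, hK.ncard_eq_two hb]
  have h2 : ∀ f ∈ Finset.univ.filter (fun f => ∃ i, K.corner f i = v),
      (Finset.bipartiteBelow (fun e f => K.IsSide e f)
        (Finset.univ.filter fun e => K.IsEnd v e) f).card = 2 := by
    intro f hf
    obtain ⟨i, rfl⟩ : ∃ i, K.corner f i = v := by simpa using hf
    have hne : K.side f i ≠ K.side f (i + 2) := by
      rw [(side_injective f).ne_iff]; clear hf h1 h; decide +revert
    rw [← Finset.card_pair hne]
    congr 1
    ext e
    simpa [Finset.bipartiteBelow] using isEnd_corner_isSide_iff f i e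
  rw [Finset.sum_congr rfl h2] at h
  have h3 := Finset.sum_congr (s₁ := Finset.univ.filter fun e => K.IsEnd v e) rfl h1
  rw [Finset.sum_add_distrib, h, ← Finset.card_filter, Finset.filter_filter] at h3
  rw [Finset.sum_const, Finset.sum_const, smul_eq_mul, smul_eq_mul] at h3
  have e1 := ncard_eq_card_filter fun e => K.IsEnd v e
  have e2 := ncard_eq_card_filter fun f => ∃ i, K.corner f i = v
  have e3 := ncard_eq_card_filter fun e => K.IsEnd v e ∧ e ∈ K.bdryEdges
  simp only [and_comm (b := K.IsEnd v _)]
  rw [← e1, ← e2, ← e3] at h3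
  omega

/-- A node of the boundary is the end of exactly two boundary edges. -/
theorem IsConnectedSurface.ncard_bdryEdges_at [Fintype E] [Fintype F]
    (hK : K.IsConnectedSurface) {v : V} (hv : v ∈ K.bdryNodes) :
    {e | e ∈ K.bdryEdges ∧ K.IsEnd v e}.ncard = 2 := by
  have h1 := hK.two_mul_card_edges_at v
  have h2 := (hK.link_connected v).card_vert_le_card_edgeSet_add_one
  have h3 := ncard_link_edgeSet_le (K := K) v
  have h4 : Nat.card {e : E // K.IsEnd v e} = {e | K.IsEnd v e}.ncard := rfl
  have h5 : Nat.card (K.link v).edgeSet = (K.link v).edgeSet.ncard := rfl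
  have h6 : {e | e ∈ K.bdryEdges ∧ K.IsEnd v e}.ncard ≠ 0 := by
    exact ((Set.ncard_pos (Set.toFinite _)).2 hv).ne'
  -- With `n` edges, `m` faces and `b` boundary edges at `v`, the count says `2 * n = 2 * m + b`,
  -- and connectedness of the link gives `n ≤ m + 1`. Hence `b` is even, at most two and non-zero.
  omega

/-- Every function on the boundary edges has, modulo two, an even sum of end values. -/
theorem IsConnectedSurface.sum_bdry_ends [Fintype V] [Fintype E] [Fintype F]
    (hK : K.IsConnectedSurface) (S : Finset E) (hS : ∀ e, e ∈ S ↔ e ∈ K.bdryEdges)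
    (q : V → ZMod 2) : ∑ e ∈ S, (q (K.tail e) + q (K.head e)) = 0 := by
  classical
  have h1 : ∀ e, q (K.tail e) + q (K.head e) = ∑ v, if K.IsEnd v e then q v else 0 := by
    intro e
    rw [← Finset.sum_filter, ← Finset.sum_pair (K.tail_ne_head e)]
    refine Finset.sum_congr (Finset.ext fun v => ?_) fun _ _ => rfl
    simp only [Finset.mem_insert, Finset.mem_singleton, Finset.mem_filter, Finset.mem_univ,
      true_and]
    rfl
  simp only [h1]
  -- Summing node by node, each boundary node is counted twice and every other node never.
  rw [Finset.sum_comm]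
  refine Finset.sum_eq_zero fun v _ => ?_
  rw [← Finset.sum_filter, Finset.sum_const]
  by_cases hv : v ∈ K.bdryNodes
  · have := hK.ncard_bdryEdges_at hv
    rw [ncard_eq_card_filter] at this
    have h2 : S.filter (fun e => K.IsEnd v e) =
        Finset.univ.filter (fun e => e ∈ K.bdryEdges ∧ K.IsEnd v e) := by
      ext e
      simp [hS]
    rw [h2, this, two_smul, CharTwo.add_self_eq_zero]
  · have h2 : S.filter (fun e => K.IsEnd v e) = ∅ := by
      ext e
      simp only [Finset.mem_filter, hS, Finset.notMem_empty, iff_false]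
      exact fun h => hv ⟨e, h⟩
    rw [h2, Finset.card_empty, zero_smul]

/-! ### Cuts of trees -/

/-- Every edge of a forest is a bridge; `S` is the component of `u` after its deletion. -/
theorem exists_cut {X : Type*} {G : SimpleGraph X} (hG : G.IsAcyclic) {u v : X} (h : G.Adj u v) :
    ∃ S : Set X, u ∈ S ∧ v ∉ S ∧ ∀ a b, G.Adj a b → s(a, b) ≠ s(u, v) → (a ∈ S ↔ b ∈ S) := by
  have hb := SimpleGraph.isBridge_iff.1 (SimpleGraph.isAcyclic_iff_forall_adj_isBridge.1 hG h)
  refine ⟨{w | (G.deleteEdges {s(u, v)}).Reachable u w}, SimpleGraph.Reachable.refl u, hb,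
    fun a b hab hne => ?_⟩
  have hadj : (G.deleteEdges {s(u, v)}).Adj a b := by
    rw [SimpleGraph.deleteEdges_adj]
    exact ⟨hab, hne⟩
  exact ⟨fun h => h.trans hadj.reachable, fun h => h.trans hadj.symm.reachable⟩

theorem eq_of_reachable {X Y : Type*} {G : SimpleGraph X} {q : X → Y}
    (h : ∀ a b, G.Adj a b → q a = q b) {a b : X} (hab : G.Reachable a b) : q a = q b := by
  obtain ⟨w⟩ := hab
  induction w with
  | nil => rfl
  | cons hadj _ ih => exact (h _ _ hadj).trans ih

theorem edgeGraph_adj {S : Set E} {u v : V} :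
    (K.edgeGraph S).Adj u v ↔ ∃ e ∈ S, s(K.tail e, K.head e) = s(u, v) := by
  constructor
  · rintro ⟨hne, e, he, hu, hv⟩
    refine ⟨e, he, ?_⟩
    rw [isEnd_iff_mem] at hu hv
    exact ((Sym2.mem_and_mem_iff hne).1 ⟨hu, hv⟩)
  · rintro ⟨e, he, h⟩
    refine ⟨?_, e, he, ?_, ?_⟩
    · rintro rfl
      have := K.tail_ne_head e
      rw [Sym2.eq_iff] at h
      grind
    · rw [isEnd_iff_mem, h]; simp
    · rw [isEnd_iff_mem, h]; simp

theorem edgeGraph_adj_ends {S : Set E} {e : E} (he : e ∈ S) :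
    (K.edgeGraph S).Adj (K.tail e) (K.head e) :=
  edgeGraph_adj.2 ⟨e, he, rfl⟩

theorem eq_ends_of_edgeGraph_adj {S : Set E} {Y : Type*} {q : V → Y}
    (h : ∀ e ∈ S, q (K.tail e) = q (K.head e)) {a b : V} (hab : (K.edgeGraph S).Adj a b) :
    q a = q b := by
  obtain ⟨e, he, hs⟩ := edgeGraph_adj.1 hab
  rcases Sym2.eq_iff.1 hs with ⟨rfl, rfl⟩ | ⟨rfl, rfl⟩
  · exact h e he
  · exact (h e he).symm

/-- A function whose values agree at the ends of every edge of `S` is constant on the components of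
the graph with edges `S`. -/
theorem eq_of_edgeGraph_reachable {S : Set E} {Y : Type*} {q : V → Y}
    (h : ∀ e ∈ S, q (K.tail e) = q (K.head e)) {a b : V} (hab : (K.edgeGraph S).Reachable a b) :
    q a = q b :=
  eq_of_reachable (fun _ _ => eq_ends_of_edgeGraph_adj h) hab

/-- An edge of a tree separates its node set into two parts. -/
theorem exists_cut_edgeGraph {T : Set E} (hinj : Set.InjOn (fun e => s(K.tail e, K.head e)) T)
    (hT : (K.edgeGraph T).IsAcyclic) {x : E} (hx : x ∈ T) :
    ∃ U : Set V, K.tail x ∈ U ∧ K.head x ∉ U ∧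
      ∀ y ∈ T, y ≠ x → (K.tail y ∈ U ↔ K.head y ∈ U) := by
  obtain ⟨U, h1, h2, h3⟩ := exists_cut hT (edgeGraph_adj_ends hx)
  exact ⟨U, h1, h2, fun y hy hne => h3 _ _ (edgeGraph_adj_ends hy) fun h => hne (hinj hy hx h)⟩

/-- If a spanning tree contains spanning trees of the boundary components, then its interior edges
do not separate the ends of a boundary edge. -/
theorem cut_bdry {T : Set E}
    (hb : ∀ u v, (K.edgeGraph K.bdryEdges).Reachable u v →
      (K.edgeGraph (T ∩ K.bdryEdges)).Reachable u v) {x : E} (hx : x ∉ K.bdryEdges) {U : Set V}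
    (hU : ∀ y ∈ T, y ≠ x → (K.tail y ∈ U ↔ K.head y ∈ U)) {y : E} (hy : y ∈ K.bdryEdges) :
    K.tail y ∈ U ↔ K.head y ∈ U := by
  have h := eq_of_edgeGraph_reachable (q := fun v => v ∈ U)
    (fun e he => propext (hU e he.1 fun h => hx (h ▸ he.2)))
    (hb _ _ (edgeGraph_adj_ends hy).reachable)
  exact iff_of_eq h

/-! ### Connectedness of the dual graph -/

/-- This is connectedness of the full dual graph. Having all its faces in `S` spreads from one edge
at a node to all others through the connected link, and then from node to node along edges.
Connected links exclude two pieces that meet only in a node. -/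
theorem IsConnectedSurface.mem_of_closed (hK : K.IsConnectedSurface) {S : Set F} (hne : S.Nonempty)
    (hS : ∀ e f f', K.IsSide e f → K.IsSide e f' → f ∈ S → f' ∈ S) (f : F) : f ∈ S := by
  have hlink : ∀ v (a b : {e : E // K.IsEnd v e}),
      (∀ f, K.IsSide a.1 f → f ∈ S) = (∀ f, K.IsSide b.1 f → f ∈ S) := by
    intro v a b
    refine eq_of_reachable (q := fun c : {e : E // K.IsEnd v e} => ∀ f, K.IsSide c.1 f → f ∈ S)
      (fun c d hcd => ?_) ((hK.link_connected v).preconnected a b)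
    obtain ⟨-, g, hc, hd⟩ := hcd
    exact propext ⟨fun h f hf => hS _ _ _ hd hf (h g hc), fun h f hf => hS _ _ _ hc hf (h g hd)⟩
  have hlink' : ∀ {v a b}, K.IsEnd v a → K.IsEnd v b → (∀ f, K.IsSide a f → f ∈ S) →
      (∀ f, K.IsSide b f → f ∈ S) := fun {v a b} ha hb h =>
    (hlink v ⟨a, ha⟩ ⟨b, hb⟩).mp h
  obtain ⟨f₀, hf₀⟩ := hne
  have h0 : ∀ f, K.IsSide (K.side f₀ 0) f → f ∈ S := fun f hf =>
    hS _ _ _ (isSide_side f₀ 0) hf hf₀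
  have hall : ∀ v, (∀ e, K.IsEnd v e → ∀ f, K.IsSide e f → f ∈ S) = True := by
    intro v
    rw [← show (∀ e, K.IsEnd (K.tail (K.side f₀ 0)) e → ∀ f, K.IsSide e f → f ∈ S) = True from
      eq_true fun e he => hlink' (isEnd_tail _) he h0]
    refine eq_of_edgeGraph_reachable (q := fun v => ∀ e, K.IsEnd v e → ∀ f, K.IsSide e f → f ∈ S)
      (fun e _ => propext ⟨fun h e' he' => ?_, fun h e' he' => ?_⟩)
      (hK.connected.preconnected v (K.tail (K.side f₀ 0)))
    · exact hlink' (isEnd_head e) he' (h e (isEnd_tail e))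
    · exact hlink' (isEnd_tail e) he' (h e (isEnd_head e))
  exact of_eq_true (hall _) _ (isEnd_tail (K.side f 0)) f (isSide_side f 0)

theorem IsConnectedSurface.nonempty_faces (hK : K.IsConnectedSurface) : Nonempty F := by
  obtain ⟨v⟩ := hK.connected.nonempty
  obtain ⟨e⟩ := (hK.link_connected v).nonempty
  exact (hK.exists_isSide e.1).nonempty

/-- The dual graph stays connected after the edges of a spanning tree that contains spanning trees
of the boundary components are removed. -/
theorem IsConnectedSurface.dualEdgeGraph_connected [Fintype E] [Fintype F]
    (hK : K.IsConnectedSurface) {T : Set E}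
    (hinj : Set.InjOn (fun e => s(K.tail e, K.head e)) T) (hT : (K.edgeGraph T).IsAcyclic)
    (hb : ∀ u v, (K.edgeGraph K.bdryEdges).Reachable u v →
      (K.edgeGraph (T ∩ K.bdryEdges)).Reachable u v) :
    (K.dualEdgeGraph (T ∪ K.bdryEdges)ᶜ).Connected := by
  classical
  have := hK.nonempty_faces
  suffices h : ∀ f₀ f, (K.dualEdgeGraph (T ∪ K.bdryEdges)ᶜ).Reachable f₀ f from ⟨h⟩
  intro f₀
  have hadj : ∀ e f f', e ∉ T → e ∉ K.bdryEdges → K.IsSide e f → K.IsSide e f' →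
      ((K.dualEdgeGraph (T ∪ K.bdryEdges)ᶜ).Reachable f₀ f ↔
        (K.dualEdgeGraph (T ∪ K.bdryEdges)ᶜ).Reachable f₀ f') := by
    intro e f f' h1 h2 hf hf'
    by_cases hne : f = f'
    · rw [hne]
    have : (K.dualEdgeGraph (T ∪ K.bdryEdges)ᶜ).Adj f f' :=
      ⟨hne, e, by simp [h1, h2], hf, hf'⟩
    exact ⟨fun h => h.trans this.reachable, fun h => h.trans this.symm.reachable⟩
  refine hK.mem_of_closed (S := {f | (K.dualEdgeGraph (T ∪ K.bdryEdges)ᶜ).Reachable f₀ f})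
    ⟨f₀, SimpleGraph.Reachable.refl _⟩ fun e f f' hf hf' hfS => ?_
  by_cases hne : f = f'
  · exact hne ▸ hfS
  have heb : e ∉ K.bdryEdges := fun h => hne (eq_of_isSide_of_mem_bdryEdges h hf hf')
  by_cases heT : e ∉ T
  · exact (hadj e f f' heT heb hf hf').1 hfS
  rw [not_not] at heT
  -- Only the crossing of a tree edge `e` needs an argument. Count modulo two the pairs of a face
  -- reachable from `f₀` and a side of it that crosses the cut `U` defined by `e`. Each face
  -- contributes an even number. Other tree edges and boundary edges do not cross the cut, and the
  -- remaining interior edges are counted from both faces or from neither. So `e` must also be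
  -- counted from both.
  obtain ⟨U, hU1, hU2, hU3⟩ := exists_cut_edgeGraph hinj hT heT
  let q : V → ZMod 2 := fun v => if v ∈ U then 1 else 0
  let r : F → E → ZMod 2 := fun h y => if (K.dualEdgeGraph (T ∪ K.bdryEdges)ᶜ).Reachable f₀ h ∧
    K.IsSide y h then q (K.tail y) + q (K.head y) else 0
  have hr0 : ∀ h y, ¬ K.IsSide y h → r h y = 0 := fun h y hy => if_neg fun h => hy h.2
  have hsum : ∑ h, ∑ y, r h y = 0 := by
    refine Finset.sum_eq_zero fun h _ => ?_
    rw [sum_eq_sum_sides (K := K) h _ (hr0 h)]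
    by_cases hh : (K.dualEdgeGraph (T ∪ K.bdryEdges)ᶜ).Reachable f₀ h
    · rw [← sum_side_indicator (K := K) q h]
      exact Finset.sum_congr rfl fun i _ => if_pos ⟨hh, isSide_side h i⟩
    · exact Finset.sum_eq_zero fun i _ => if_neg fun h' => hh h'.1
  rw [Finset.sum_comm, Finset.sum_eq_single e] at hsum
  · rw [hK.sum_faces_interior hf hf' hne _ fun h => hr0 h e] at hsum
    have h1 : r f e = 1 := by
      simp only [r, q]
      rw [if_pos ⟨hfS, hf⟩, if_pos hU1, if_neg hU2, add_zero]
    by_contra hf'S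
    have h2 : r f' e = 0 := if_neg fun h => hf'S h.1
    rw [h1, h2] at hsum
    exact absurd hsum (by decide)
  · intro y _ hye
    have hq : ∀ y, (K.tail y ∈ U ↔ K.head y ∈ U) → ∀ h, r h y = 0 := by
      intro y hy h
      simp only [r, q, hy, CharTwo.add_self_eq_zero, ite_self]
    by_cases hyT : y ∈ T
    · exact Finset.sum_eq_zero fun h _ => hq y (hU3 y hyT hye) h
    by_cases hyb : y ∈ K.bdryEdges
    · exact Finset.sum_eq_zero fun h _ => hq y (cut_bdry hb heb hU3 hyb) h
    obtain ⟨a, b, ha, hb', hab⟩ := hK.exists_faces y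
    rw [hK.sum_faces_interior ha hb' (hab hyb) _ fun h => hr0 h y]
    have : r a y = r b y := by
      simp only [r, hadj y a b hyT hyb ha hb', ha, hb']
    rw [this, CharTwo.add_self_eq_zero]
  · simp

/-! ### Existence of the trees -/

/-- A spanning forest of the boundary graph extends to a spanning tree of the simple graph on the
nodes. Because of parallel edges, each of its adjacencies is then lifted to one actual edge, taken
from the boundary when it belongs to the forest. -/
theorem exists_treeEdges (hK : K.IsConnectedSurface) :
    ∃ T : Set E, Set.InjOn (fun e => s(K.tail e, K.head e)) T ∧ (K.edgeGraph T).IsTree ∧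
      ∀ u v, (K.edgeGraph K.bdryEdges).Reachable u v →
        (K.edgeGraph (T ∩ K.bdryEdges)).Reachable u v := by
  obtain ⟨H, hHle, hHac, hHr⟩ := (K.edgeGraph K.bdryEdges).exists_isAcyclic_reachable_eq_le
  have hle : K.edgeGraph K.bdryEdges ≤ K.edgeGraph Set.univ := by
    intro u v h
    obtain ⟨e, -, he⟩ := edgeGraph_adj.1 h
    exact edgeGraph_adj.2 ⟨e, trivial, he⟩
  obtain ⟨G, hHG, hGle, hG⟩ :=
    hK.connected.exists_isTree_le_of_le_of_isAcyclic (hHle.trans hle) hHac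
  have hlift : ∀ p ∈ G.edgeSet, ∃ e, s(K.tail e, K.head e) = p ∧
      (p ∈ H.edgeSet → e ∈ K.bdryEdges) := by
    intro p
    induction p with
    | h a b =>
      intro hp
      by_cases hH : H.Adj a b
      · obtain ⟨e, he, hs⟩ := edgeGraph_adj.1 (hHle hH)
        exact ⟨e, hs, fun _ => he⟩
      · obtain ⟨e, he, hs⟩ := edgeGraph_adj.1 (hGle hp)
        exact ⟨e, hs, fun h => (hH h).elim⟩
  choose φ hφ hφb using hlift
  have hgraph : K.edgeGraph {e | ∃ p hp, φ p hp = e} = G := by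
    ext u v
    rw [edgeGraph_adj]
    constructor
    · rintro ⟨_, ⟨p, hp, rfl⟩, hs⟩
      rw [hφ] at hs
      rwa [hs] at hp
    · intro h
      exact ⟨φ s(u, v) h, ⟨_, _, rfl⟩, hφ _ _⟩
  refine ⟨{e | ∃ p hp, φ p hp = e}, ?_, by rw [hgraph]; exact hG, fun u v h => ?_⟩
  · rintro _ ⟨p, hp, rfl⟩ _ ⟨p', hp', rfl⟩ h
    simp only [hφ] at h
    subst h
    rfl
  · rw [← hHr] at h
    refine h.mono fun a b hab => edgeGraph_adj.2 ⟨φ s(a, b) (hHG hab), ⟨⟨_, _, rfl⟩, ?_⟩, hφ _ _⟩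
    exact hφb _ _ hab

/-- A spanning tree of the simple dual graph is lifted to edges of `K`. As an edge has at most two
faces, the lift has exactly the prescribed pair, so distinct adjacencies have lifts with distinct
face sets. -/
theorem exists_dualTreeEdges (hK : K.IsConnectedSurface) {S : Set E}
    (hS : (K.dualEdgeGraph S).Connected) :
    ∃ D ⊆ S, Set.InjOn (fun e => {f | K.IsSide e f}) D ∧ (K.dualEdgeGraph D).IsTree := by
  obtain ⟨G, hGle, hG⟩ := hS.exists_isTree_le
  have hlift : ∀ p ∈ G.edgeSet, ∃ e ∈ S, ∀ f, K.IsSide e f ↔ f ∈ p := by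
    intro p
    induction p with
    | h a b =>
      intro hp
      obtain ⟨hne, e, he, ha, hb⟩ := hGle hp
      refine ⟨e, he, fun f => ⟨fun hf => ?_, fun hf => ?_⟩⟩
      · simpa using hK.eq_or_eq_of_isSide ha hb hne hf
      · rcases Sym2.mem_iff.1 hf with rfl | rfl <;> assumption
  choose φ hφS hφ using hlift
  have hgraph : K.dualEdgeGraph {e | ∃ p hp, φ p hp = e} = G := by
    ext u v
    constructor
    · rintro ⟨hne, _, ⟨p, hp, rfl⟩, hu, hv⟩
      rw [hφ] at hu hv
      rwa [(Sym2.mem_and_mem_iff hne).1 ⟨hu, hv⟩] at hp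
    · intro h
      exact ⟨h.ne, φ s(u, v) h, ⟨_, _, rfl⟩, (hφ _ _ _).2 (by simp), (hφ _ _ _).2 (by simp)⟩
  refine ⟨{e | ∃ p hp, φ p hp = e}, ?_, ?_, by rw [hgraph]; exact hG⟩
  · rintro _ ⟨p, hp, rfl⟩
    exact hφS p hp
  · rintro _ ⟨p, hp, rfl⟩ _ ⟨p', hp', rfl⟩ h
    have : p = p' := Sym2.ext fun f => by
      rw [← hφ p hp, ← hφ p' hp']
      exact iff_of_eq (congrFun h f)
    subst this
    rfl

theorem exists_isDualWalk {S : Set E} {f f' : F} (w : (K.dualEdgeGraph S).Walk f f') :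
    ∃ p, K.IsDualWalk S f p f' ∧ f :: p.map Prod.snd = w.support := by
  induction w with
  | nil => exact ⟨[], rfl, rfl⟩
  | cons h w ih =>
    obtain ⟨p, hp, hs⟩ := ih
    obtain ⟨hne, e, he, h1, h2⟩ := id h
    exact ⟨(e, _) :: p, ⟨⟨he, hne, h1, h2⟩, hp⟩, by rw [SimpleGraph.Walk.support_cons, ← hs]; rfl⟩

theorem IsConnectedSurface.mem_of_isDualWalk (hK : K.IsConnectedSurface) {S : Set E} {f f' : F}
    {p : List (E × F)} (hp : K.IsDualWalk S f p f') {x : E} (hx : x ∈ p.map Prod.fst) {h : F}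
    (hh : K.IsSide x h) : h ∈ f :: p.map Prod.snd := by
  induction p generalizing f with
  | nil => simp at hx
  | cons a p ih =>
    obtain ⟨⟨-, hne, h1, h2⟩, hp⟩ := hp
    rw [List.map_cons, List.mem_cons] at hx
    rcases hx with rfl | hx
    · rcases hK.eq_or_eq_of_isSide h1 h2 hne hh with rfl | rfl <;> simp
    · exact List.mem_cons_of_mem _ (ih hp hx)

theorem IsConnectedSurface.exists_isDualPath (hK : K.IsConnectedSurface) {S : Set E}
    (hS : (K.dualEdgeGraph S).Connected) (f f' : F) : ∃ p, K.IsDualPath S f p f' := by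
  classical
  obtain ⟨w, hw⟩ := (hS.preconnected f f').exists_isPath
  obtain ⟨p, hp, hs⟩ := exists_isDualWalk w
  have hnd : (f :: p.map Prod.snd).Nodup := hs ▸ hw.support_nodup
  refine ⟨p, hp, hnd, ?_⟩
  clear hw hs w
  induction p generalizing f with
  | nil => simp
  | cons a p ih =>
    obtain ⟨⟨-, hne, h1, h2⟩, hp⟩ := hp
    rw [List.map_cons, List.nodup_cons] at hnd ⊢
    -- Distinct faces force distinct edges: crossing the first edge again would bring the walk back
    -- to its first face.
    exact ⟨fun ha => hnd.1 (hK.mem_of_isDualWalk hp ha h1), ih _ hp hnd.2⟩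

theorem nonempty_trees [Fintype E] [Fintype F] (hK : K.IsConnectedSurface) :
    Nonempty K.Trees := by
  obtain ⟨T, hinj, hT, hb⟩ := exists_treeEdges hK
  obtain ⟨D, hD, hDinj, hDT⟩ := exists_dualTreeEdges hK
    (hK.dualEdgeGraph_connected hinj hT.isAcyclic hb)
  choose face₁ face₂ h₁ h₂ hne using hK.exists_faces
  choose path hpath using hK.exists_isDualPath hDT.connected
  exact ⟨⟨T, hinj, hT, hb, D, hD, hDinj, hDT, face₁, face₂, h₁, h₂, hne, path, hpath⟩⟩

theorem nonempty_choices [Fintype E] [Fintype F] (hK : K.IsConnectedSurface)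
    (A : K.BdrySubcomplex) : Nonempty (Choices A) := by
  obtain ⟨t⟩ := nonempty_trees hK
  choose ce hce using fun j : Contact A => j.exists_rep
  exact ⟨⟨t, fun h => h.some, fun h => h.some_mem, fun h => h.some, fun h => h.some_mem,
    fun h => h.some, fun h => h.some, ce, hce⟩⟩

/-! ### Orientations of the faces that are coherent along the dual tree -/

variable (K) in
/-- The incidence number of a face and an edge after the faces are reoriented by the signs `σ`. -/
noncomputable def eps (σ : F → ℝ) (f : F) (e : E) : ℝ := σ f * K.inc₂ f e

variable (K) in
/-- The signs `σ` orient the faces coherently across the edges of `D`. -/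
structure IsCoherent (D : Set E) (σ : F → ℝ) : Prop where
  sign : ∀ f, σ f = 1 ∨ σ f = -1
  eps_eq_neg : ∀ x ∈ D, ∀ f f', f ≠ f' → K.IsSide x f → K.IsSide x f' →
    K.eps σ f x = -K.eps σ f' x

theorem eps_eq_zero {σ : F → ℝ} {f : F} {e : E} (h : ¬ K.IsSide e f) : K.eps σ f e = 0 := by
  rw [eps, inc₂_eq_zero h, Int.cast_zero, mul_zero]

namespace IsCoherent

variable {D : Set E} {σ : F → ℝ}

theorem eps_eq_one_or (hσ : K.IsCoherent D σ) {f : F} {e : E} (h : K.IsSide e f) :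
    K.eps σ f e = 1 ∨ K.eps σ f e = -1 := by
  rw [eps]
  rcases hσ.sign f with h1 | h1 <;> rcases inc₂_eq_one_or h with h2 | h2 <;> rw [h1, h2] <;> simp

theorem eps_mul_self (hσ : K.IsCoherent D σ) {f : F} {e : E} (h : K.IsSide e f) :
    K.eps σ f e * K.eps σ f e = 1 := by
  rcases hσ.eps_eq_one_or h with h | h <;> rw [h] <;> norm_num

theorem eps_ne_zero (hσ : K.IsCoherent D σ) {f : F} {e : E} (h : K.IsSide e f) :
    K.eps σ f e ≠ 0 := by
  rcases hσ.eps_eq_one_or h with h | h <;> rw [h] <;> norm_num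

theorem inc₂_div (hσ : K.IsCoherent D σ) {f : F} {a b : E} (ha : K.IsSide a f)
    (hb : K.IsSide b f) :
    (K.inc₂ f b : ℝ) / (K.inc₂ f a : ℝ) = K.eps σ f a * K.eps σ f b := by
  rw [eps, eps]
  rcases hσ.sign f with h1 | h1 <;> rcases inc₂_eq_one_or ha with h2 | h2 <;>
    rcases inc₂_eq_one_or hb with h3 | h3 <;> rw [h1, h2, h3] <;> norm_num

theorem sum_eps_mul [Fintype E] (f : F) (g : E → ℝ) :
    ∑ x, K.eps σ f x * g x = σ f * K.δ₁ g f := by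
  rw [δ₁_apply, Finset.mul_sum]
  exact Finset.sum_congr rfl fun x _ => by rw [eps, mul_assoc]

theorem mem_ker_δ₁ [Fintype E] (hσ : K.IsCoherent D σ) {g : E → ℝ} :
    g ∈ LinearMap.ker K.δ₁ ↔ ∀ f, ∑ x, K.eps σ f x * g x = 0 := by
  rw [LinearMap.mem_ker, funext_iff]
  refine forall_congr' fun f => ?_
  have : σ f ≠ 0 := by rcases hσ.sign f with h | h <;> rw [h] <;> norm_num
  rw [sum_eps_mul, mul_eq_zero]
  simp [this]

end IsCoherent

open Classical in
theorem IsConnectedSurface.eps_interior (hK : K.IsConnectedSurface) {σ : F → ℝ} {e : E}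
    {f f' : F} (hf : K.IsSide e f) (hf' : K.IsSide e f') (hne : f ≠ f') (h : F) :
    K.eps σ h e = K.eps σ f e * (if h = f then 1 else 0) +
      K.eps σ f' e * (if h = f' then 1 else 0) := by
  by_cases hh : K.IsSide e h
  · rcases hK.eq_or_eq_of_isSide hf hf' hne hh with rfl | rfl
    · simp [hne]
    · simp [hne.symm]
  · have h1 : h ≠ f := by rintro rfl; exact hh hf
    have h2 : h ≠ f' := by rintro rfl; exact hh hf'
    simp [h1, h2, eps_eq_zero hh]

open Classical in
theorem eps_bdry {σ : F → ℝ} {e : E} (he : e ∈ K.bdryEdges) {f : F} (hf : K.IsSide e f) (h : F) :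
    K.eps σ h e = K.eps σ f e * (if h = f then 1 else 0) := by
  by_cases hh : K.IsSide e h
  · simp [eq_of_isSide_of_mem_bdryEdges he hh hf]
  · have h1 : h ≠ f := by rintro rfl; exact hh hf
    simp [h1, eps_eq_zero hh]

/-- An edge of a dual tree separates the faces into two parts. -/
theorem exists_cut_dualEdgeGraph {D : Set E}
    (hinj : Set.InjOn (fun e => {f | K.IsSide e f}) D) (hD : (K.dualEdgeGraph D).IsAcyclic)
    (hK : K.IsConnectedSurface) {x : E} (hx : x ∈ D) {f f' : F} (hne : f ≠ f')
    (hf : K.IsSide x f) (hf' : K.IsSide x f') :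
    ∃ S : Set F, f ∈ S ∧ f' ∉ S ∧ ∀ y ∈ D, y ≠ x → ∀ h h', K.IsSide y h → K.IsSide y h' →
      (h ∈ S ↔ h' ∈ S) := by
  obtain ⟨S, h1, h2, h3⟩ := exists_cut hD (u := f) (v := f') ⟨hne, x, hx, hf, hf'⟩
  refine ⟨S, h1, h2, fun y hy hyx h h' hh hh' => ?_⟩
  by_cases heq : h = h'
  · rw [heq]
  refine h3 h h' ⟨heq, y, hy, hh, hh'⟩ fun hs => hyx (hinj hy hx ?_)
  have hiff : ∀ (e : E) (a b : F), a ≠ b → K.IsSide e a → K.IsSide e b →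
      {f | K.IsSide e f} = {f | f ∈ s(a, b)} := by
    intro e a b hab ha hb
    ext c
    constructor
    · intro hc
      exact Sym2.mem_iff.2 (hK.eq_or_eq_of_isSide ha hb hab hc)
    · intro hc
      rcases Sym2.mem_iff.1 hc with rfl | rfl <;> assumption
  show {f | K.IsSide y f} = {f | K.IsSide x f}
  rw [hiff y h h' heq hh hh', hiff x f f' hne hf hf', hs]

theorem Trees.not_mem_bdryEdges (t : K.Trees) {x : E} (hx : x ∈ t.dualTreeEdges) :
    x ∉ K.bdryEdges := fun h => t.dual_subset hx (Or.inr h)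

theorem Trees.not_mem_treeEdges (t : K.Trees) {x : E} (hx : x ∈ t.dualTreeEdges) :
    x ∉ t.treeEdges := fun h => t.dual_subset hx (Or.inl h)

theorem Trees.exists_dual_cut (t : K.Trees) (hK : K.IsConnectedSurface) {x : E}
    (hx : x ∈ t.dualTreeEdges) :
    ∃ S : Set F, t.face₁ x ∈ S ∧ t.face₂ x ∉ S ∧ ∀ y ∈ t.dualTreeEdges, y ≠ x →
      ∀ h h', K.IsSide y h → K.IsSide y h' → (h ∈ S ↔ h' ∈ S) :=
  exists_cut_dualEdgeGraph t.dual_faces_inj t.dual_isTree.isAcyclic hK hx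
    (t.face_ne x (t.not_mem_bdryEdges hx)) (t.face₁_side x) (t.face₂_side x)

/-- Each dual tree edge cuts the faces in two, and `τ x` is the product that the signs at the two
faces of `x` must have. The sign of a face is the product of `τ x` over the cuts that have it on the
side of `face₁ x`. The faces at `x` are separated by the cut of `x` alone, so their signs multiply
to `τ x`. -/
theorem Trees.exists_isCoherent [Finite E] (t : K.Trees) (hK : K.IsConnectedSurface) :
    ∃ σ, K.IsCoherent t.dualTreeEdges σ := by
  classical
  have := Fintype.ofFinite E
  choose S hS1 hS2 hS3 using fun x : t.dualTreeEdges => t.exists_dual_cut hK x.2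
  let τ : E → ℝ := fun x => -((K.inc₂ (t.face₁ x) x : ℝ) * K.inc₂ (t.face₂ x) x)
  have hτ : ∀ x, τ x * τ x = 1 := by
    intro x
    simp only [τ]
    rcases inc₂_eq_one_or (t.face₁_side x) with h1 | h1 <;>
      rcases inc₂_eq_one_or (t.face₂_side x) with h2 | h2 <;> rw [h1, h2] <;> norm_num
  let a : F → t.dualTreeEdges → ℝ := fun f x => if f ∈ S x then τ x else 1
  have ha : ∀ f x, a f x * a f x = 1 := by
    intro f x
    simp only [a]
    split_ifs
    · exact hτ x
    · norm_num
  have hsign : ∀ f, (∏ x, a f x) = 1 ∨ (∏ x, a f x) = -1 := by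
    intro f
    rw [← mul_self_eq_one_iff, ← Finset.prod_mul_distrib]
    exact Finset.prod_eq_one fun x _ => ha f x
  refine ⟨fun f => ∏ x, a f x, hsign, ?_⟩
  have key : ∀ x ∈ t.dualTreeEdges, K.eps (fun f => ∏ x, a f x) (t.face₁ x) x =
      -K.eps (fun f => ∏ x, a f x) (t.face₂ x) x := by
    intro x hx
    have hprod : (∏ y, a (t.face₁ x) y) * (∏ y, a (t.face₂ x) y) = τ x := by
      rw [← Finset.prod_mul_distrib, Finset.prod_eq_single ⟨x, hx⟩]
      · simp only [a]
        rw [if_pos (hS1 ⟨x, hx⟩), if_neg (hS2 ⟨x, hx⟩), mul_one]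
      · intro y _ hy
        have : a (t.face₁ x) y = a (t.face₂ x) y := by
          simp only [a, hS3 y x hx (fun h => hy (Subtype.ext h.symm)) _ _ (t.face₁_side x)
            (t.face₂_side x)]
        rw [this, ha]
      · simp
    simp only [eps]
    rcases hsign (t.face₁ x) with h1 | h1 <;> rcases hsign (t.face₂ x) with h2 | h2 <;>
      rw [h1, h2] at hprod ⊢ <;>
      rcases inc₂_eq_one_or (t.face₁_side x) with h3 | h3 <;>
      rcases inc₂_eq_one_or (t.face₂_side x) with h4 | h4 <;>
      simp only [τ, h3, h4] at hprod ⊢ <;> first | (norm_num; done) | norm_num at hprod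
  intro x hx f f' hne hf hf'
  have hne' := t.face_ne x (t.not_mem_bdryEdges hx)
  have h1 := hK.eq_or_eq_of_isSide (t.face₁_side x) (t.face₂_side x) hne' hf
  have h2 := hK.eq_or_eq_of_isSide (t.face₁_side x) (t.face₂_side x) hne' hf'
  have h3 := key x hx
  rcases h1 with rfl | rfl <;> rcases h2 with rfl | rfl
  · exact (hne rfl).elim
  · exact h3
  · rw [h3, neg_neg]
  · exact (hne rfl).elim

/-! ### The cochain of a dual path -/

theorem cross_of_ne {f : F} {a b y : E} (g : E → ℝ) (h : y ≠ b) : K.cross f a b g y = g y := by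
  classical
  rw [cross, Function.update_of_ne h]

theorem IsCoherent.cross_self {D : Set E} {σ : F → ℝ} (hσ : K.IsCoherent D σ) {f : F} {a b : E}
    (ha : K.IsSide a f) (hb : K.IsSide b f) (g : E → ℝ) :
    K.cross f a b g b = -(K.eps σ f a * K.eps σ f b * g a) := by
  classical
  rw [cross, Function.update_self, hσ.inc₂_div ha hb, neg_mul]

-- The assignment rule and coherence give `eps σ f₂ x * g x = eps σ f a * g a`: the current entering
-- each successive face is the same. It cancels at intermediate faces, leaving a source term at the
-- first face and a sink term at the last.
open Classical in
theorem IsCoherent.transport_spec {D : Set E} {σ : F → ℝ} (hσ : K.IsCoherent D σ)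
    (hK : K.IsConnectedSurface) {e' : E} {f' : F} (he' : K.IsSide e' f') (p : List (E × F)) :
    ∀ (a : E) (f : F) (g : E → ℝ), K.IsDualWalk D f p f' → (p.map Prod.fst).Nodup →
      K.IsSide a f → a ∉ p.map Prod.fst → e' ∉ p.map Prod.fst →
      (∀ y, y ∉ p.map Prod.fst → y ≠ e' → K.transport e' a f p g y = g y) ∧
      K.transport e' a f p g e' = -(K.eps σ f a * K.eps σ f' e' * g a) ∧
      ∀ h, ((p.map Prod.fst).map fun x => K.eps σ h x * K.transport e' a f p g x).sum =
        K.eps σ f a * g a * ((if h = f' then 1 else 0) - (if h = f then 1 else 0)) := by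
  induction p with
  | nil =>
    rintro a f g hw - ha - -
    obtain rfl : f = f' := hw
    exact ⟨fun y _ hy => cross_of_ne g hy, hσ.cross_self ha he' g, fun h => by simp⟩
  | cons q p ih =>
    obtain ⟨x, f₂⟩ := q
    rintro a f g ⟨⟨hxD, hne, hxf, hxf₂⟩, hw⟩ hnd ha hap hep
    simp only [List.map_cons, List.nodup_cons, List.mem_cons, not_or] at hnd hap hep
    obtain ⟨ih1, ih2, ih3⟩ := ih x f₂ (K.cross f a x g) hw hnd.2 hxf₂ hnd.1 hep.2
    have hx := hσ.cross_self ha hxf g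
    have hc := hσ.eps_eq_neg x hxD f f₂ hne hxf hxf₂
    have hsq := hσ.eps_mul_self hxf₂
    refine ⟨fun y hy hye => ?_, ?_, fun h => ?_⟩
    · simp only [List.map_cons, List.mem_cons, not_or] at hy
      rw [transport, ih1 y hy.2 hye, cross_of_ne g hy.1]
    · rw [transport, ih2, hx, hc]
      linear_combination (-(K.eps σ f a * K.eps σ f' e' * g a)) * hsq
    · simp only [List.map_cons, List.sum_cons]
      simp only [transport]
      rw [ih3 h, ih1 x hnd.1 (Ne.symm hep.1), hx, hK.eps_interior hxf hxf₂ hne h, hc]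
      linear_combination (K.eps σ f a * g a * ((if h = f' then 1 else 0) -
        (if h = f then 1 else 0))) * hsq

theorem IsDualWalk.mem {S : Set E} {f f' : F} {p : List (E × F)} (hp : K.IsDualWalk S f p f')
    {x : E} (hx : x ∈ p.map Prod.fst) : x ∈ S := by
  induction p generalizing f with
  | nil => simp at hx
  | cons q p ih =>
    rw [List.map_cons, List.mem_cons] at hx
    rcases hx with rfl | hx
    · exact hp.1.1
    · exact ih hp.2 hx

/-! ### The cochains of the algorithm as currents in the dual tree -/

namespace Trees

variable (t : K.Trees)

open Classical in
/-- Apart from its values on `e` and `e'`, the cochain `g` is the cochain of the flow in the dual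
tree that enters at the face `f` and leaves at the face `f'`. -/
structure IsPathFlow [Fintype E] (σ : F → ℝ) (e e' : E) (f f' : F) (g : E → ℝ) : Prop where
  off : ∀ y, y ∉ t.dualTreeEdges → y ≠ e → y ≠ e' → g y = 0
  flow : ∀ h, (∑ x, if x ∈ t.dualTreeEdges then K.eps σ h x * g x else 0) =
    K.eps σ f e * ((if h = f' then 1 else 0) - (if h = f then 1 else 0))

variable {t} {σ : F → ℝ}

open Classical in
theorem transport_path_spec [Fintype E] (hσ : K.IsCoherent t.dualTreeEdges σ)
    (hK : K.IsConnectedSurface) {e e' : E} {f f' : F} (he : e ∉ t.dualTreeEdges)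
    (he' : e' ∉ t.dualTreeEdges) (hef : K.IsSide e f) (hef' : K.IsSide e' f') {g : E → ℝ}
    (hg : g = K.transport e' e f (t.path f f') (Function.update 0 e 1)) :
    (e ≠ e' → g e = 1) ∧ g e' = -(K.eps σ f e * K.eps σ f' e') ∧ t.IsPathFlow σ e e' f f' g := by
  obtain ⟨hw, -, hnd⟩ := t.path_isPath f f'
  have hmem : ∀ {x}, x ∈ (t.path f f').map Prod.fst → x ∈ t.dualTreeEdges := hw.mem
  obtain ⟨h1, h2, h3⟩ := hσ.transport_spec hK hef' (t.path f f') e f (Function.update 0 e 1) hw hnd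
    hef (fun h => he (hmem h)) (fun h => he' (hmem h))
  rw [← hg] at h1 h2 h3
  have hoff : ∀ y, y ∉ (t.path f f').map Prod.fst → y ≠ e → y ≠ e' → g y = 0 := by
    intro y hy hye hye'
    rw [h1 y hy hye', Function.update_of_ne hye, Pi.zero_apply]
  refine ⟨fun hne => ?_, ?_, fun y hy => hoff y fun h => hy (hmem h), fun h => ?_⟩
  · rw [h1 e (fun h => he (hmem h)) hne, Function.update_self]
  · rw [h2, Function.update_self, mul_one]
  · have h4 := h3 h
    rw [Function.update_self, mul_one] at h4
    rw [← h4, ← List.sum_toFinset _ hnd, ← Finset.sum_filter]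
    refine (Finset.sum_subset (fun x hx => ?_) fun x hx hx' => ?_).symm
    · simpa using hmem (List.mem_toFinset.1 hx)
    · have hxD : x ∈ t.dualTreeEdges := (Finset.mem_filter.1 hx).2
      rw [hoff x (fun h => hx' (List.mem_toFinset.2 h)) (by rintro rfl; exact he hxD)
        (by rintro rfl; exact he' hxD), mul_zero]

theorem cochain_spec [Fintype E] (hσ : K.IsCoherent t.dualTreeEdges σ)
    (hK : K.IsConnectedSurface) {e e' : E} {f f' : F} (he : e ∉ t.dualTreeEdges)
    (he' : e' ∉ t.dualTreeEdges) (hef : K.IsSide e f) (hef' : K.IsSide e' f') (hne : e ≠ e') :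
    t.cochain e e' f f' e = 1 ∧ t.cochain e e' f f' e' = -(K.eps σ f e * K.eps σ f' e') ∧
      t.IsPathFlow σ e e' f f' (t.cochain e e' f f') := by
  classical
  obtain ⟨h1, h2, h3⟩ := transport_path_spec hσ hK he he' hef hef' rfl
  have : t.cochain e e' f f' = K.transport e' e f (t.path f f') (Function.update 0 e 1) := by
    rw [cochain, pathCochain]
    exact if_pos (h1 hne)
  rw [this]
  exact ⟨h1 hne, h2, h3⟩

/-- The last assignment puts minus the product of the two signs at `e` back on `e`, and this is the
initial `1` exactly when the signs are opposite. -/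
theorem loopCochain_of_coherent [Fintype E] (hσ : K.IsCoherent t.dualTreeEdges σ)
    (hK : K.IsConnectedSurface) {e : E} (he : e ∉ t.dualTreeEdges)
    (hc : K.eps σ (t.face₁ e) e = -K.eps σ (t.face₂ e) e) :
    t.loopCochain e e = 1 ∧ t.IsPathFlow σ e e (t.face₁ e) (t.face₂ e) (t.loopCochain e) := by
  classical
  obtain ⟨-, h2, h3⟩ := transport_path_spec hσ hK he he (t.face₁_side e) (t.face₂_side e) rfl
  rw [hc, neg_mul, neg_neg, hσ.eps_mul_self (t.face₂_side e)] at h2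
  have : t.loopCochain e = K.transport e e (t.face₁ e) (t.path (t.face₁ e) (t.face₂ e))
      (Function.update 0 e 1) := by
    rw [loopCochain, cochain, pathCochain]
    exact if_pos h2
  rw [this]
  exact ⟨h2, h3⟩

theorem loopCochain_of_not_coherent [Fintype E] (hσ : K.IsCoherent t.dualTreeEdges σ)
    (hK : K.IsConnectedSurface) {e : E} (he : e ∉ t.dualTreeEdges)
    (hc : K.eps σ (t.face₁ e) e = K.eps σ (t.face₂ e) e) : t.loopCochain e = 0 := by
  classical
  obtain ⟨-, h2, h3⟩ := transport_path_spec hσ hK he he (t.face₁_side e) (t.face₂_side e) rfl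
  rw [hc, hσ.eps_mul_self (t.face₂_side e)] at h2
  rw [loopCochain, cochain, pathCochain]
  refine if_neg ?_
  rw [h2]
  norm_num

theorem not_mem_bdry_of_mem_EM {e : E} (he : e ∈ t.EM) : e ∉ K.bdryEdges :=
  fun h => he.2 (Or.inr ⟨h, he.1⟩)

theorem not_mem_dual_of_mem_EM {e : E} (he : e ∈ t.EM) : e ∉ t.dualTreeEdges :=
  fun h => he.2 (Or.inl h)

theorem mem_EM_of_not_mem {e : E} (h1 : e ∉ t.treeEdges) (h2 : e ∉ t.dualTreeEdges)
    (h3 : e ∉ K.bdryEdges) : e ∈ t.EM :=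
  ⟨h1, fun h => h.elim h2 fun h => h3 h.1⟩

theorem eps_eq_or_neg (hσ : K.IsCoherent t.dualTreeEdges σ) (e : E) :
    K.eps σ (t.face₁ e) e = K.eps σ (t.face₂ e) e ∨
      K.eps σ (t.face₁ e) e = -K.eps σ (t.face₂ e) e := by
  rcases hσ.eps_eq_one_or (t.face₁_side e) with h1 | h1 <;>
    rcases hσ.eps_eq_one_or (t.face₂_side e) with h2 | h2 <;> simp [h1, h2]

/-- This turns the outcome of the test in `pathCochain` into failure of coherence across the edge.
-/
theorem mem_EMII_iff [Fintype E] (hσ : K.IsCoherent t.dualTreeEdges σ)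
    (hK : K.IsConnectedSurface) {e : E} :
    e ∈ t.EMII ↔ e ∈ t.EM ∧ K.eps σ (t.face₁ e) e = K.eps σ (t.face₂ e) e := by
  refine and_congr_right fun he => ⟨fun h => ?_, fun h => ?_⟩
  · refine (eps_eq_or_neg hσ e).resolve_right fun h' => ?_
    have := (loopCochain_of_coherent hσ hK (not_mem_dual_of_mem_EM he) h').1
    rw [h] at this
    simp at this
  · exact loopCochain_of_not_coherent hσ hK (not_mem_dual_of_mem_EM he) h

open Classical in
/-- Splitting off the edges outside the dual tree on which a cochain does not vanish. -/
theorem sum_eps_split [Fintype E] (g : E → ℝ) (s : Finset E)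
    (hs : ∀ x ∈ s, x ∉ t.dualTreeEdges) (hg : ∀ y, y ∉ t.dualTreeEdges → y ∉ s → g y = 0)
    (h : F) : ∑ x, K.eps σ h x * g x = ∑ x ∈ s, K.eps σ h x * g x +
      ∑ x, if x ∈ t.dualTreeEdges then K.eps σ h x * g x else 0 := by
  rw [← Finset.sum_filter_add_sum_filter_not Finset.univ (· ∈ t.dualTreeEdges), add_comm,
    ← Finset.sum_filter]
  congr 1
  refine (Finset.sum_subset (fun x hx => by simpa using hs x hx) fun x hx hx' => ?_).symm
  rw [hg x (by simpa using hx) hx', mul_zero]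

/-- The loop cochain of a coherent edge is a cocycle. -/
theorem loopCochain_mem_ker [Fintype E] (hσ : K.IsCoherent t.dualTreeEdges σ)
    (hK : K.IsConnectedSurface) {e : E} (he : e ∈ t.EM)
    (hc : K.eps σ (t.face₁ e) e = -K.eps σ (t.face₂ e) e) :
    t.loopCochain e ∈ LinearMap.ker K.δ₁ := by
  classical
  obtain ⟨h1, h2⟩ := loopCochain_of_coherent hσ hK (not_mem_dual_of_mem_EM he) hc
  rw [hσ.mem_ker_δ₁]
  intro h
  rw [sum_eps_split (t := t) _ {e} (by simpa using not_mem_dual_of_mem_EM he)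
    (fun y hy hys => h2.off y hy (by simpa using hys) (by simpa using hys)), h2.flow,
    Finset.sum_singleton, h1, hK.eps_interior (t.face₁_side e) (t.face₂_side e)
      (t.face_ne e (not_mem_bdry_of_mem_EM he)), hc]
  ring

/-- The current enters at `e` and leaves at `e'`. Each has a single face, so nothing else has to
balance. -/
theorem cochain_bdry_mem_ker [Fintype E] (hσ : K.IsCoherent t.dualTreeEdges σ)
    (hK : K.IsConnectedSurface) {e e' : E} (he : e ∈ K.bdryEdges) (he' : e' ∈ K.bdryEdges)
    (hne : e ≠ e') : t.cochain e e' (t.face₁ e) (t.face₁ e') ∈ LinearMap.ker K.δ₁ := by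
  classical
  have hD : ∀ {x}, x ∈ K.bdryEdges → x ∉ t.dualTreeEdges := fun hx h => t.not_mem_bdryEdges h hx
  obtain ⟨h1, h2, h3⟩ := cochain_spec hσ hK (hD he) (hD he') (t.face₁_side e) (t.face₁_side e') hne
  rw [hσ.mem_ker_δ₁]
  intro h
  rw [sum_eps_split (t := t) _ {e, e'} (by simpa using ⟨hD he, hD he'⟩)
    (fun y hy hys => h3.off y hy (by rintro rfl; simp at hys) (by rintro rfl; simp at hys)),
    h3.flow, Finset.sum_pair hne, h1, h2, eps_bdry he (t.face₁_side e),
    eps_bdry he' (t.face₁_side e')]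
  linear_combination (-(K.eps σ (t.face₁ e) e * (if h = t.face₁ e' then 1 else 0))) *
    hσ.eps_mul_self (t.face₁_side e')

/-- Across an edge of `EMII` the two signs agree, so the value `1` on `e` feeds equal currents into
both its faces, and one value on `s` absorbs both. Hence the two path flows add up on the dual tree,
while `e` and `s` keep the value from a single one. -/
theorem twistedCochain_spec [Fintype E] (hσ : K.IsCoherent t.dualTreeEdges σ)
    (hK : K.IsConnectedSurface) {e s : E} (he : e ∈ t.EMII) (hs : s ∈ t.EMII) (hne : e ≠ s) :
    t.twistedCochain e s ∈ LinearMap.ker K.δ₁ ∧ t.twistedCochain e s e = 1 ∧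
      ∀ y, y ∉ t.dualTreeEdges → y ≠ e → y ≠ s → t.twistedCochain e s y = 0 := by
  classical
  have heD := not_mem_dual_of_mem_EM he.1
  have hsD := not_mem_dual_of_mem_EM hs.1
  obtain ⟨a1, a2, a3⟩ := cochain_spec hσ hK heD hsD (t.face₁_side e) (t.face₁_side s) hne
  obtain ⟨b1, b2, b3⟩ := cochain_spec hσ hK heD hsD (t.face₂_side e) (t.face₂_side s) hne
  have he2 := ((mem_EMII_iff hσ hK).1 he).2
  have hs2 := ((mem_EMII_iff hσ hK).1 hs).2
  have hoff : ∀ y, y ∉ t.dualTreeEdges → y ≠ e → y ≠ s → t.twistedCochain e s y = 0 := by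
    intro y hy hye hys
    rw [twistedCochain, if_neg (by simp [hye, hys]), a3.off y hy hye hys, b3.off y hy hye hys,
      add_zero]
  have hflow : ∀ h, (∑ x, if x ∈ t.dualTreeEdges then K.eps σ h x * t.twistedCochain e s x
      else 0) = (∑ x, if x ∈ t.dualTreeEdges then
        K.eps σ h x * t.cochain e s (t.face₁ e) (t.face₁ s) x else 0) +
      ∑ x, if x ∈ t.dualTreeEdges then
        K.eps σ h x * t.cochain e s (t.face₂ e) (t.face₂ s) x else 0 := by
    intro h
    rw [← Finset.sum_add_distrib]
    refine Finset.sum_congr rfl fun x _ => ?_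
    by_cases hx : x ∈ t.dualTreeEdges
    · have h1 : x ≠ e := by rintro rfl; exact heD hx
      have h2 : x ≠ s := by rintro rfl; exact hsD hx
      rw [if_pos hx, if_pos hx, if_pos hx, twistedCochain, if_neg (by simp [h1, h2]), mul_add]
    · simp [hx]
  have hve : t.twistedCochain e s e = 1 := by rw [twistedCochain, if_pos (Or.inl rfl), a1]
  have hvs : t.twistedCochain e s s = -(K.eps σ (t.face₁ e) e * K.eps σ (t.face₁ s) s) := by
    rw [twistedCochain, if_pos (Or.inr rfl), a2]
  refine ⟨hσ.mem_ker_δ₁.2 fun h => ?_, hve, hoff⟩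
  rw [sum_eps_split (t := t) _ {e, s} (by simpa using ⟨heD, hsD⟩)
    (fun y hy hys => hoff y hy (by rintro rfl; simp at hys) (by rintro rfl; simp at hys)),
    hflow, a3.flow, b3.flow, Finset.sum_pair hne, hve, hvs,
    hK.eps_interior (t.face₁_side e) (t.face₂_side e) (t.face_ne e (not_mem_bdry_of_mem_EM he.1)),
    hK.eps_interior (t.face₁_side s) (t.face₂_side s) (t.face_ne s (not_mem_bdry_of_mem_EM hs.1)),
    he2, hs2]
  linear_combination (-(K.eps σ (t.face₂ e) e * ((if h = t.face₁ s then 1 else 0) +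
    (if h = t.face₂ s then 1 else 0)))) * hσ.eps_mul_self (t.face₂_side s)

/-- Both flows start at the only face of `e`, so `e` must carry `2`. They end at the two faces of
`s`, where a single value absorbs both because the signs agree. -/
theorem extraCochain_spec [Fintype E] (hσ : K.IsCoherent t.dualTreeEdges σ)
    (hK : K.IsConnectedSurface) {e s : E} (he : e ∈ K.bdryEdges) (hs : s ∈ t.EMII) :
    t.extraCochain e s ∈ LinearMap.ker K.δ₁ ∧ t.extraCochain e s e = 2 ∧
      ∀ y, y ∉ t.dualTreeEdges → y ≠ e → y ≠ s → t.extraCochain e s y = 0 := by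
  classical
  have hne : e ≠ s := by rintro rfl; exact not_mem_bdry_of_mem_EM hs.1 he
  have heD : e ∉ t.dualTreeEdges := fun h => t.not_mem_bdryEdges h he
  have hsD := not_mem_dual_of_mem_EM hs.1
  obtain ⟨a1, a2, a3⟩ := cochain_spec hσ hK heD hsD (t.face₁_side e) (t.face₁_side s) hne
  obtain ⟨b1, b2, b3⟩ := cochain_spec hσ hK heD hsD (t.face₁_side e) (t.face₂_side s) hne
  have hs2 := ((mem_EMII_iff hσ hK).1 hs).2
  have hoff : ∀ y, y ∉ t.dualTreeEdges → y ≠ e → y ≠ s → t.extraCochain e s y = 0 := by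
    intro y hy hye hys
    rw [extraCochain, if_neg hys, a3.off y hy hye hys, b3.off y hy hye hys, add_zero]
  have hflow : ∀ h, (∑ x, if x ∈ t.dualTreeEdges then K.eps σ h x * t.extraCochain e s x
      else 0) = (∑ x, if x ∈ t.dualTreeEdges then
        K.eps σ h x * t.cochain e s (t.face₁ e) (t.face₁ s) x else 0) +
      ∑ x, if x ∈ t.dualTreeEdges then
        K.eps σ h x * t.cochain e s (t.face₁ e) (t.face₂ s) x else 0 := by
    intro h
    rw [← Finset.sum_add_distrib]
    refine Finset.sum_congr rfl fun x _ => ?_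
    by_cases hx : x ∈ t.dualTreeEdges
    · have h2 : x ≠ s := by rintro rfl; exact hsD hx
      rw [if_pos hx, if_pos hx, if_pos hx, extraCochain, if_neg h2, mul_add]
    · simp [hx]
  have hve : t.extraCochain e s e = 2 := by
    rw [extraCochain, if_neg hne, a1, b1]; norm_num
  have hvs : t.extraCochain e s s = -(K.eps σ (t.face₁ e) e * K.eps σ (t.face₁ s) s) := by
    rw [extraCochain, if_pos rfl, a2]
  refine ⟨hσ.mem_ker_δ₁.2 fun h => ?_, hve, hoff⟩
  rw [sum_eps_split (t := t) _ {e, s} (by simpa using ⟨heD, hsD⟩)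
    (fun y hy hys => hoff y hy (by rintro rfl; simp at hys) (by rintro rfl; simp at hys)),
    hflow, a3.flow, b3.flow, Finset.sum_pair hne, hve, hvs,
    eps_bdry he (t.face₁_side e),
    hK.eps_interior (t.face₁_side s) (t.face₂_side s) (t.face_ne s (not_mem_bdry_of_mem_EM hs.1)),
    hs2]
  linear_combination (-(K.eps σ (t.face₁ e) e * ((if h = t.face₁ s then 1 else 0) +
    (if h = t.face₂ s then 1 else 0)))) * hσ.eps_mul_self (t.face₂_side s)

end Trees

/-! ### The generators are relative cocycles -/

theorem Hole.hasNode_iff_of_mem_bdryEdges (k : K.Hole) {e : E} (he : e ∈ K.bdryEdges) :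
    k.HasNode (K.tail e) ↔ k.HasNode (K.head e) := by
  have h1 : K.tail e ∈ K.bdryNodes := ⟨e, he, isEnd_tail e⟩
  have h2 : K.head e ∈ K.bdryNodes := ⟨e, he, isEnd_head e⟩
  have h : SimpleGraph.connectedComponentMk ((K.edgeGraph K.bdryEdges).induce K.bdryNodes)
      (⟨K.tail e, h1⟩ : K.bdryNodes) = SimpleGraph.connectedComponentMk _ ⟨K.head e, h2⟩ := by
    refine SimpleGraph.ConnectedComponent.sound (SimpleGraph.Adj.reachable ?_)
    exact edgeGraph_adj_ends he
  constructor
  · rintro ⟨_, rfl⟩; exact ⟨h2, h.symm⟩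
  · rintro ⟨_, rfl⟩; exact ⟨h1, h⟩

namespace Choices

variable {A : K.BdrySubcomplex} (c : Choices A)

theorem ha_mem_ker [Fintype E] {σ : F → ℝ} (hσ : K.IsCoherent c.dualTreeEdges σ)
    (hK : K.IsConnectedSurface) (i : c.HaIndex) : c.ha i ∈ LinearMap.ker K.δ₁ := by
  by_cases h : i.1 ∈ c.EMII
  · rw [ha, dif_pos h]
    exact (Trees.twistedCochain_spec hσ hK h (c.star_mem _) (i.2.2 _)).1
  · rw [ha, dif_neg h]
    refine Trees.loopCochain_mem_ker hσ hK i.2.1 ((Trees.eps_eq_or_neg hσ i.1).resolve_left ?_)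
    exact fun h' => h ((Trees.mem_EMII_iff hσ hK).2 ⟨i.2.1, h'⟩)

/-- Together with `ha_off` this makes the handle generators an identity matrix on the edges that
index them. -/
theorem ha_self [Fintype E] {σ : F → ℝ} (hσ : K.IsCoherent c.dualTreeEdges σ)
    (hK : K.IsConnectedSurface) (i : c.HaIndex) : c.ha i i.1 = 1 := by
  by_cases h : i.1 ∈ c.EMII
  · rw [ha, dif_pos h]
    exact (Trees.twistedCochain_spec hσ hK h (c.star_mem _) (i.2.2 _)).2.1
  · rw [ha, dif_neg h]
    refine (Trees.loopCochain_of_coherent hσ hK (Trees.not_mem_dual_of_mem_EM i.2.1)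
      ((Trees.eps_eq_or_neg hσ i.1).resolve_left ?_)).1
    exact fun h' => h ((Trees.mem_EMII_iff hσ hK).2 ⟨i.2.1, h'⟩)

theorem ha_off [Fintype E] {σ : F → ℝ} (hσ : K.IsCoherent c.dualTreeEdges σ)
    (hK : K.IsConnectedSurface) (i : c.HaIndex) {y : E} (hy : y ∉ c.dualTreeEdges) (hyi : y ≠ i.1)
    (hys : ∀ h, y ≠ c.star h) : c.ha i y = 0 := by
  by_cases h : i.1 ∈ c.EMII
  · rw [ha, dif_pos h]
    exact (Trees.twistedCochain_spec hσ hK h (c.star_mem _) (i.2.2 _)).2.2 y hy hyi (hys _)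
  · rw [ha, dif_neg h]
    refine (Trees.loopCochain_of_coherent hσ hK (Trees.not_mem_dual_of_mem_EM i.2.1)
      ((Trees.eps_eq_or_neg hσ i.1).resolve_left ?_)).2.off y hy hyi hyi
    exact fun h' => h ((Trees.mem_EMII_iff hσ hK).2 ⟨i.2.1, h'⟩)

theorem ha_eq_zero [Fintype E] {σ : F → ℝ} (hσ : K.IsCoherent c.dualTreeEdges σ)
    (hK : K.IsConnectedSurface) (i : c.HaIndex) {y : E} (hy : y ∉ c.dualTreeEdges)
    (hyM : y ∉ c.EM) : c.ha i y = 0 :=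
  c.ha_off hσ hK i hy (by rintro rfl; exact hyM i.2.1)
    fun h => by rintro rfl; exact hyM (c.star_mem h).1

theorem ha_mem_Z1 [Fintype E] {σ : F → ℝ} (hσ : K.IsCoherent c.dualTreeEdges σ)
    (hK : K.IsConnectedSurface) (i : c.HaIndex) : c.ha i ∈ Z1 A :=
  ⟨fun _ hy => c.ha_eq_zero hσ hK i
    (fun h => c.not_mem_bdryEdges h (A.edges_subset hy))
    (fun h => Trees.not_mem_bdry_of_mem_EM h (A.edges_subset hy)), c.ha_mem_ker hσ hK i⟩

theorem ho_bdry [Fintype V] (k : c.HoIndex) {y : E} (hy : y ∈ K.bdryEdges) : c.ho k y = 0 := by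
  classical
  rw [ho, δ₀_apply]
  simp only [k.1.hasNode_iff_of_mem_bdryEdges hy, sub_self]

theorem ho_mem_Z1 [Fintype V] [Fintype E] (k : c.HoIndex) : c.ho k ∈ Z1 A :=
  ⟨fun _ hy => c.ho_bdry k (A.edges_subset hy), LinearMap.mem_ker.2 (δ₁_δ₀ _)⟩

theorem contactEdge_injective : Function.Injective c.contactEdge := fun i j h => by
  rw [← c.contactEdge_mem i, ← c.contactEdge_mem j, h]

theorem co_mem_ker [Fintype E] {σ : F → ℝ} (hσ : K.IsCoherent c.dualTreeEdges σ)
    (hK : K.IsConnectedSurface) (j : c.CoIndex) : c.co j ∈ LinearMap.ker K.δ₁ := by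
  by_cases h : j.1 ≠ c.lastContact ⟨j.1⟩
  · rw [co, dif_pos h]
    exact Trees.cochain_bdry_mem_ker hσ hK (c.contactEdge _).2.1 (c.contactEdge _).2.1
      fun h' => h (c.contactEdge_injective (Subtype.ext h'))
  · rw [co, dif_neg h]
    exact (Trees.extraCochain_spec hσ hK (c.contactEdge _).2.1 (c.star'_mem _)).1

theorem co_off [Fintype E] {σ : F → ℝ} (hσ : K.IsCoherent c.dualTreeEdges σ)
    (hK : K.IsConnectedSurface) (j : c.CoIndex) {y : E} (hy : y ∉ c.dualTreeEdges)
    (hyM : y ∉ c.EM) (hyj : y ≠ (c.contactEdge j.1).1)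
    (hyl : y ≠ (c.contactEdge (c.lastContact ⟨j.1⟩)).1) : c.co j y = 0 := by
  by_cases h : j.1 ≠ c.lastContact ⟨j.1⟩
  · rw [co, dif_pos h]
    have hD : ∀ {x}, x ∈ K.bdryEdges → x ∉ c.dualTreeEdges := fun hx h => c.not_mem_bdryEdges h hx
    exact (Trees.cochain_spec hσ hK (hD (c.contactEdge _).2.1) (hD (c.contactEdge _).2.1)
      (c.face₁_side _) (c.face₁_side _)
      fun h' => h (c.contactEdge_injective (Subtype.ext h'))).2.2.off y hy hyj hyl
  · rw [co, dif_neg h]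
    refine (Trees.extraCochain_spec hσ hK (c.contactEdge _).2.1 (c.star'_mem _)).2.2 y hy hyl ?_
    rintro rfl
    exact hyM (c.star'_mem _).1

theorem co_self [Fintype E] {σ : F → ℝ} (hσ : K.IsCoherent c.dualTreeEdges σ)
    (hK : K.IsConnectedSurface) (j : c.CoIndex) (h : j.1 ≠ c.lastContact ⟨j.1⟩) :
    c.co j (c.contactEdge j.1).1 = 1 := by
  rw [co, dif_pos h]
  have hD : ∀ {x}, x ∈ K.bdryEdges → x ∉ c.dualTreeEdges := fun hx h => c.not_mem_bdryEdges h hx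
  exact (Trees.cochain_spec hσ hK (hD (c.contactEdge _).2.1) (hD (c.contactEdge _).2.1)
    (c.face₁_side _) (c.face₁_side _)
    fun h' => h (c.contactEdge_injective (Subtype.ext h'))).1

theorem co_last [Fintype E] {σ : F → ℝ} (hσ : K.IsCoherent c.dualTreeEdges σ)
    (hK : K.IsConnectedSurface) (j : c.CoIndex) (h : j.1 = c.lastContact ⟨j.1⟩) :
    c.co j (c.contactEdge j.1).1 = 2 := by
  have h' : ¬ j.1 ≠ c.lastContact ⟨j.1⟩ := not_not.2 h
  rw [co, dif_neg h']
  have := (Trees.extraCochain_spec hσ hK (c.contactEdge (c.lastContact ⟨j.1⟩)).2.1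
    (c.star'_mem (j.2.resolve_right h'))).2.1
  exact (congrArg _ (congrArg (fun k => (c.contactEdge k).1) h)).trans this

theorem co_mem_Z1 [Fintype E] {σ : F → ℝ} (hσ : K.IsCoherent c.dualTreeEdges σ)
    (hK : K.IsConnectedSurface) (j : c.CoIndex) : c.co j ∈ Z1 A := by
  refine ⟨fun y hy => ?_, c.co_mem_ker hσ hK j⟩
  have h : ∀ k, y ≠ (c.contactEdge k).1 := by
    rintro k rfl
    exact (c.contactEdge k).2.2 hy
  exact c.co_off hσ hK j (fun h => c.not_mem_bdryEdges h (A.edges_subset hy))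
    (fun h => Trees.not_mem_bdry_of_mem_EM h (A.edges_subset hy)) (h _) (h _)

end Choices

/-! ### Cochains on the contacts -/

/-- If the coboundary of a `0`-cochain that vanishes on `A` is zero on all edges of a contact but
one, then it is zero on that edge. -/
theorem IsConnectedSurface.eq_ends_of_contact [Fintype V] [Fintype E] [Fintype F]
    (hK : K.IsConnectedSurface) {A : K.BdrySubcomplex}
    (e₀ : {e : E // e ∈ K.bdryEdges ∧ e ∉ A.edges}) {u : V → ℝ} (hu : ∀ v ∈ A.nodes, u v = 0)
    (hconst : ∀ x, x ≠ e₀ → (contactGraph A).Reachable e₀ x → u (K.tail x.1) = u (K.head x.1)) :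
    u (K.tail e₀.1) = u (K.head e₀.1) := by
  classical
  by_contra hne
  obtain ⟨a, b, ha, hb, ha0, hab⟩ : ∃ a b, K.IsEnd a e₀.1 ∧ K.IsEnd b e₀.1 ∧ u a ≠ 0 ∧
      u b ≠ u a := by
    by_cases h0 : u (K.tail e₀.1) = 0
    · exact ⟨_, _, isEnd_head _, isEnd_tail _, fun h => hne (h0.trans h.symm), hne⟩
    · exact ⟨_, _, isEnd_tail _, isEnd_head _, h0, Ne.symm hne⟩
  -- Since `u a ≠ 0`, nodes of `U` lie outside `A`, so every boundary edge at such a node belongs to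
  -- the contact of `e₀`. Hence `e₀` would be the only boundary edge leaving `U`, contradicting
  -- `sum_bdry_ends`.
  let U : Set V := {v | u v = u a ∧ ∃ x, (contactGraph A).Reachable e₀ x ∧ K.IsEnd v x.1}
  let q : V → ZMod 2 := fun v => if v ∈ U then 1 else 0
  have hU : ∀ x ∈ K.bdryEdges, x ≠ e₀.1 → ∀ v v', K.IsEnd v x → K.IsEnd v' x → v ∈ U →
      v' ∈ U := by
    rintro x hx hxe v v' hv hv' ⟨hva, y, hy, hvy⟩
    have hvA : v ∉ A.nodes := fun h => ha0 (hva.symm.trans (hu v h))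
    have hxA : x ∉ A.edges := fun h => hvA (A.closed x h v hv)
    have hyx : (contactGraph A).Reachable y ⟨x, hx, hxA⟩ := by
      by_cases h : y = ⟨x, hx, hxA⟩
      · rw [h]
      · exact SimpleGraph.Adj.reachable ⟨h, v, hvA, hvy, hv⟩
    have hends := hconst ⟨x, hx, hxA⟩ (fun h => hxe (congrArg Subtype.val h)) (hy.trans hyx)
    refine ⟨?_, ⟨x, hx, hxA⟩, hy.trans hyx, hv'⟩
    rw [← hva]
    rcases hv with rfl | rfl <;> rcases hv' with rfl | rfl
    · rfl
    · exact hends.symm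
    · exact hends
    · rfl
  have hsum := hK.sum_bdry_ends (Finset.univ.filter (· ∈ K.bdryEdges)) (by simp) q
  rw [Finset.sum_eq_single e₀.1] at hsum
  · have haU : a ∈ U := ⟨rfl, e₀, SimpleGraph.Reachable.refl _, ha⟩
    have hbU : b ∉ U := fun h => hab h.1
    have h1 : q a = 1 := if_pos haU
    have h2 : q b = 0 := if_neg hbU
    have hne' : a ≠ b := by rintro rfl; exact hab rfl
    rcases ha with rfl | rfl <;> rcases hb with rfl | rfl
    · exact hne' rfl
    · rw [h1, h2] at hsum; exact absurd hsum (by decide)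
    · rw [h1, h2] at hsum; exact absurd hsum (by decide)
    · exact hne' rfl
  · intro x hx hxe
    have hx' : x ∈ K.bdryEdges := by simpa using hx
    have : K.tail x ∈ U ↔ K.head x ∈ U :=
      ⟨hU x hx' hxe _ _ (isEnd_tail x) (isEnd_head x),
        hU x hx' hxe _ _ (isEnd_head x) (isEnd_tail x)⟩
    simp only [q, this, CharTwo.add_self_eq_zero]
  · intro h
    exact (h (by simpa using e₀.2.1)).elim

/-- A `1`-cochain that vanishes on `A` coincides, on all boundary edges but one in each contact,
with the coboundary of a `0`-cochain that vanishes on `A`. -/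
theorem IsConnectedSurface.exists_eq_δ₀_on_bdry [Fintype V] [Fintype E] [Fintype F]
    (hK : K.IsConnectedSurface) {A : K.BdrySubcomplex}
    (ce : Contact A → {e : E // e ∈ K.bdryEdges ∧ e ∉ A.edges})
    (hce : ∀ j, (contactGraph A).connectedComponentMk (ce j) = j) {g : E → ℝ}
    (hg : ∀ x ∈ A.edges, g x = 0) :
    ∃ u : V → ℝ, (∀ v ∈ A.nodes, u v = 0) ∧
      ∀ x ∈ K.bdryEdges, (∀ j, x ≠ (ce j).1) → K.δ₀ u x = g x := by
  classical
  let N : Set E := {x | x ∈ K.bdryEdges ∧ ∀ j, x ≠ (ce j).1}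
  suffices h : g ∈ B1 A ⊔ vanishingOn N by
    obtain ⟨y, ⟨u, hu, rfl⟩, z, hz, rfl⟩ := Submodule.mem_sup.1 h
    refine ⟨u, hu, fun x hx hxj => ?_⟩
    rw [Pi.add_apply, hz x ⟨hx, hxj⟩, add_zero]
  -- Duality replaces an explicit potential along the contacts: a functional `φ` kills the relative
  -- coboundaries and all cochains vanishing on `N`, but not `g`. Its coefficients `a` are supported
  -- on `N`.
  by_contra hgW
  obtain ⟨φ, hφg, hφW⟩ := Submodule.exists_le_ker_of_notMem hgW
  have hB : ∀ y ∈ B1 A, φ y = 0 := fun y hy => hφW (Submodule.mem_sup_left hy)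
  have hN : ∀ y ∈ vanishingOn N, φ y = 0 := fun y hy => hφW (Submodule.mem_sup_right hy)
  let a : E → ℝ := fun x => φ (Pi.single x 1)
  have hφ : ∀ h : E → ℝ, φ h = ∑ x, h x * a x := by
    intro h
    conv_lhs => rw [pi_eq_sum_univ' h]
    rw [map_sum]
    refine Finset.sum_congr rfl fun x _ => ?_
    rw [map_smul, smul_eq_mul]
  have haN : ∀ x, x ∉ N → a x = 0 := by
    intro x hx
    refine hN _ fun y hy => ?_
    rw [Pi.single_apply, if_neg]
    rintro rfl
    exact hx hy
  have hadj : ∀ x y, (contactGraph A).Adj x y → |a x.1| = |a y.1| := by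
    rintro x y ⟨hxy, v, hvA, hvx, hvy⟩
    have hxy' : x.1 ≠ y.1 := fun h => hxy (Subtype.ext h)
    have h2 := hK.ncard_bdryEdges_at (v := v) ⟨x.1, x.2.1, hvx⟩
    have hsub : ∀ z ∈ K.bdryEdges, K.IsEnd v z → z = x.1 ∨ z = y.1 := by
      obtain ⟨p, q, hpq, hs⟩ := Set.ncard_eq_two.1 h2
      have hmem : ∀ z, z ∈ K.bdryEdges → K.IsEnd v z → z = p ∨ z = q := by
        intro z hz hz'
        have : z ∈ ({p, q} : Set E) := hs ▸ ⟨hz, hz'⟩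
        simpa using this
      have hx := hmem x.1 x.2.1 hvx
      have hy := hmem y.1 y.2.1 hvy
      intro z hz hz'
      have hz := hmem z hz hz'
      grind
    -- Only `x` and `y` are boundary edges at `v`, so testing `φ` on this coboundary makes their
    -- coefficients agree up to sign. As `a` is zero on the chosen edge, it is zero on the whole
    -- contact.
    have h0 : φ (K.δ₀ (Pi.single v 1)) = 0 := by
      refine hB _ ⟨_, fun w hw => ?_, rfl⟩
      rw [Pi.single_apply, if_neg]
      rintro rfl
      exact hvA hw
    have hend : ∀ z, K.IsEnd v z → |K.δ₀ (Pi.single v 1) z| = 1 := by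
      intro z hz
      have := K.tail_ne_head z
      rw [δ₀_apply]
      rcases hz with rfl | rfl
      · simp [this.symm]
      · simp [this]
    have hnend : ∀ z, ¬ K.IsEnd v z → K.δ₀ (Pi.single v (1 : ℝ)) z = 0 := by
      intro z hz
      simp only [IsEnd, not_or] at hz
      rw [δ₀_apply, Pi.single_apply, Pi.single_apply, if_neg (Ne.symm hz.1),
        if_neg (Ne.symm hz.2), sub_zero]
    rw [hφ, ← Finset.sum_subset (Finset.subset_univ {x.1, y.1}), Finset.sum_pair hxy'] at h0
    · have := congrArg abs (eq_neg_of_add_eq_zero_left h0)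
      rwa [abs_neg, abs_mul, abs_mul, hend _ hvx, hend _ hvy, one_mul, one_mul] at this
    · intro z _ hz
      simp only [Finset.mem_insert, Finset.mem_singleton] at hz
      by_cases hzb : z ∈ K.bdryEdges
      · rw [hnend z fun h => hz (hsub z hzb h), zero_mul]
      · rw [haN z fun h => hzb h.1, mul_zero]
  have ha : ∀ x : {e : E // e ∈ K.bdryEdges ∧ e ∉ A.edges}, a x.1 = 0 := by
    intro x
    have hr : (contactGraph A).Reachable (ce ((contactGraph A).connectedComponentMk x)) x :=
      SimpleGraph.ConnectedComponent.exact (hce _)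
    have h := eq_of_reachable (q := fun z : {e : E // e ∈ K.bdryEdges ∧ e ∉ A.edges} => |a z.1|)
      hadj hr
    rw [haN _ fun h => h.2 _ rfl, abs_zero] at h
    exact abs_eq_zero.1 h.symm
  refine hφg ?_
  rw [hφ]
  refine Finset.sum_eq_zero fun x _ => ?_
  by_cases hxA : x ∈ A.edges
  · rw [hg x hxA, zero_mul]
  by_cases hxb : x ∈ K.bdryEdges
  · rw [ha ⟨x, hxb, hxA⟩, mul_zero]
  · rw [haN x fun h => hxb h.1, mul_zero]

/-! ### The constraint from the coherent orientation -/

/-- The sum of all face equations, each multiplied by its sign. An edge across which the orientation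
is coherent drops out, so this constrains only boundary edges and incoherent edges. -/
theorem sum_sum_eps_mul [Fintype E] [Fintype F] (σ : F → ℝ) {g : E → ℝ}
    (hg : g ∈ LinearMap.ker K.δ₁) :
    ∑ x, (∑ f, K.eps σ f x) * g x = 0 := by
  simp only [Finset.sum_mul]
  rw [Finset.sum_comm]
  refine Finset.sum_eq_zero fun f _ => ?_
  rw [IsCoherent.sum_eps_mul, LinearMap.mem_ker.1 hg, Pi.zero_apply, mul_zero]

namespace Trees

variable {t : K.Trees} {σ : F → ℝ}

theorem sum_eps_interior [Fintype F] (hK : K.IsConnectedSurface) {x : E} (hx : x ∉ K.bdryEdges) :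
    ∑ f, K.eps σ f x = K.eps σ (t.face₁ x) x + K.eps σ (t.face₂ x) x :=
  hK.sum_faces_interior (t.face₁_side x) (t.face₂_side x) (t.face_ne x hx) _
    fun _ h => eps_eq_zero h

theorem sum_eps_dual [Fintype F] (hσ : K.IsCoherent t.dualTreeEdges σ)
    (hK : K.IsConnectedSurface) {x : E} (hx : x ∈ t.dualTreeEdges) : ∑ f, K.eps σ f x = 0 := by
  rw [sum_eps_interior (t := t) hK (t.not_mem_bdryEdges hx),
    hσ.eps_eq_neg x hx _ _ (t.face_ne x (t.not_mem_bdryEdges hx)) (t.face₁_side x)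
      (t.face₂_side x), neg_add_cancel]

theorem sum_eps_EMII_ne_zero [Fintype E] [Fintype F] (hσ : K.IsCoherent t.dualTreeEdges σ)
    (hK : K.IsConnectedSurface) {x : E} (hx : x ∈ t.EMII) : ∑ f, K.eps σ f x ≠ 0 := by
  rw [sum_eps_interior (t := t) hK (not_mem_bdry_of_mem_EM hx.1), ((mem_EMII_iff hσ hK).1 hx).2]
  have := hσ.eps_ne_zero (t.face₂_side x)
  intro h
  exact this (by linarith)

theorem sum_eps_bdry_ne_zero [Fintype F] (hσ : K.IsCoherent t.dualTreeEdges σ) {x : E}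
    (hx : x ∈ K.bdryEdges) : ∑ f, K.eps σ f x ≠ 0 := by
  rw [sum_faces_bdry hx (t.face₁_side x) _ fun _ h => eps_eq_zero h]
  exact hσ.eps_ne_zero (t.face₁_side x)

/-- If all edges of `EM` are coherent, then all interior edges are. -/
theorem sum_eps_eq_zero_of_EMII_empty [Fintype V] [Fintype E] [Fintype F]
    (hσ : K.IsCoherent t.dualTreeEdges σ)
    (hK : K.IsConnectedSurface) (hII : ¬ t.EMII.Nonempty) {x : E} (hx : x ∉ K.bdryEdges) :
    ∑ f, K.eps σ f x = 0 := by
  classical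
  have hnt : ∀ y, y ∉ K.bdryEdges → y ∉ t.treeEdges → ∑ f, K.eps σ f y = 0 := by
    intro y hyb hyT
    by_cases hyD : y ∈ t.dualTreeEdges
    · exact sum_eps_dual hσ hK hyD
    · rw [sum_eps_interior (t := t) hK hyb, (eps_eq_or_neg hσ y).resolve_left, neg_add_cancel]
      exact fun h => hII ⟨y, (mem_EMII_iff hσ hK).2 ⟨mem_EM_of_not_mem hyT hyD hyb, h⟩⟩
  by_cases hxT : x ∈ t.treeEdges
  · obtain ⟨U, h1, h2, h3⟩ := exists_cut_edgeGraph t.tree_ends_inj t.tree_isTree.isAcyclic hxT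
    -- The coboundary of the cut indicator is itself a cocycle; among the edges of non-zero weight
    -- it can be non-zero only on `x`.
    have h := sum_sum_eps_mul σ (g := K.δ₀ fun v => if v ∈ U then 1 else 0)
      (LinearMap.mem_ker.2 (δ₁_δ₀ _))
    rw [Finset.sum_eq_single x] at h
    · rw [δ₀_apply, if_pos h1, if_neg h2] at h
      linarith
    · intro y _ hyx
      have hU : (K.tail y ∈ U ↔ K.head y ∈ U) →
          (∑ f, K.eps σ f y) * K.δ₀ (fun v => if v ∈ U then 1 else 0) y = 0 := by
        intro h
        rw [δ₀_apply]
        simp only [h, sub_self, mul_zero]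
      by_cases hyT : y ∈ t.treeEdges
      · exact hU (h3 y hyT hyx)
      by_cases hyb : y ∈ K.bdryEdges
      · exact hU (cut_bdry t.tree_bdry hx h3 hyb)
      · rw [hnt y hyb hyT, zero_mul]
    · simp
  · exact hnt x hx hxT

/-- A cocycle supported on the edges of the dual tree is zero. -/
theorem eq_zero_of_support_dual [Fintype E] [Fintype F] (hσ : K.IsCoherent t.dualTreeEdges σ)
    (hK : K.IsConnectedSurface) {g : E → ℝ} (hg : g ∈ LinearMap.ker K.δ₁)
    (hs : ∀ y, y ∉ t.dualTreeEdges → g y = 0) : g = 0 := by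
  classical
  funext x
  by_cases hx : x ∉ t.dualTreeEdges
  · exact hs x hx
  rw [not_not] at hx
  obtain ⟨S, h1, h2, h3⟩ := t.exists_dual_cut hK hx
  -- Adding the face equations on one side of the cut leaves only the current through `x`: all other
  -- dual tree edges have both faces on the same side and cancel.
  have hsum : ∑ f, ∑ y, (if f ∈ S then K.eps σ f y else 0) * g y = 0 := by
    refine Finset.sum_eq_zero fun f _ => ?_
    by_cases hf : f ∈ S
    · simpa [hf] using hσ.mem_ker_δ₁.1 hg f
    · simp [hf]
  rw [Finset.sum_comm, Finset.sum_eq_single x] at hsum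
  · rw [← Finset.sum_mul, hK.sum_faces_interior (t.face₁_side x) (t.face₂_side x)
      (t.face_ne x (t.not_mem_bdryEdges hx)) _ (fun h hh => by rw [eps_eq_zero hh, ite_self]),
      if_pos h1, if_neg h2, add_zero] at hsum
    exact (mul_eq_zero.1 hsum).resolve_left (hσ.eps_ne_zero (t.face₁_side x))
  · intro y _ hyx
    by_cases hy : y ∈ t.dualTreeEdges
    · have hne := t.face_ne y (t.not_mem_bdryEdges hy)
      rw [← Finset.sum_mul, hK.sum_faces_interior (t.face₁_side y) (t.face₂_side y)
        hne _ (fun h hh => by rw [eps_eq_zero hh, ite_self]),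
        hσ.eps_eq_neg y hy _ _ hne (t.face₁_side y) (t.face₂_side y)]
      simp only [h3 y hy hyx _ _ (t.face₁_side y) (t.face₂_side y)]
      split_ifs <;> simp
    · simp [hs y hy]
  · simp

/-- Every `1`-cochain is, on the edges of the spanning tree, the coboundary of a `0`-cochain. -/
theorem exists_δ₀_eq_on_tree [Fintype V] [Finite E] (t : K.Trees) (g : E → ℝ) :
    ∃ u : V → ℝ, ∀ x ∈ t.treeEdges, K.δ₀ u x = g x := by
  classical
  have := Fintype.ofFinite E
  choose U h1 h2 h3 using fun x : t.treeEdges =>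
    exists_cut_edgeGraph t.tree_ends_inj t.tree_isTree.isAcyclic x.2
  -- The indicator of `U x` has coboundary `-1` on `x`, whose tail lies in `U x`, and `0` on all
  -- other tree edges.
  refine ⟨∑ x : t.treeEdges, (-g x) • fun v => if v ∈ U x then (1 : ℝ) else 0, fun x hx => ?_⟩
  rw [map_sum, Finset.sum_apply, Finset.sum_eq_single ⟨x, hx⟩]
  · rw [map_smul, Pi.smul_apply, δ₀_apply, if_pos (h1 ⟨x, hx⟩), if_neg (h2 ⟨x, hx⟩)]
    simp
  · intro y _ hy
    rw [map_smul, Pi.smul_apply, δ₀_apply]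
    simp only [h3 y x hx fun h => hy (Subtype.ext h.symm), sub_self, smul_zero]
  · simp

end Trees

/-! ### Nodes of holes and functions constant on them -/

theorem Hole.exists_hasNode {v : V} (hv : v ∈ K.bdryNodes) : ∃ k : K.Hole, k.HasNode v :=
  ⟨_, hv, rfl⟩

theorem Hole.eq_of_hasNode {k k' : K.Hole} {v : V} (h : k.HasNode v) (h' : k'.HasNode v) :
    k = k' := by
  obtain ⟨_, rfl⟩ := h
  obtain ⟨_, rfl⟩ := h'
  rfl

theorem Hole.exists_node (k : K.Hole) : ∃ v, k.HasNode v := by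
  obtain ⟨v, rfl⟩ := k.exists_rep
  exact ⟨v.1, v.2, rfl⟩

theorem Hole.reachable {k : K.Hole} {v w : V} (hv : k.HasNode v) (hw : k.HasNode w) :
    (K.edgeGraph K.bdryEdges).Reachable v w := by
  obtain ⟨hv, rfl⟩ := hv
  obtain ⟨hw, h⟩ := hw
  have := SimpleGraph.ConnectedComponent.exact h
  exact (this.map (SimpleGraph.Embedding.induce K.bdryNodes).toHom).symm

theorem IsConnectedSurface.eq_const_of_tree [Fintype V] (hK : K.IsConnectedSurface) (t : K.Trees)
    {u : V → ℝ} (hu : ∀ x ∈ t.treeEdges, K.δ₀ u x = 0) : ∃ r, ∀ v, u v = r := by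
  obtain ⟨v₀⟩ := hK.connected.nonempty
  refine ⟨u v₀, fun v => eq_of_edgeGraph_reachable (fun x hx => ?_)
    (t.tree_isTree.connected.preconnected v v₀)⟩
  have := hu x hx
  rw [δ₀_apply] at this
  linarith

namespace Choices

variable {A : K.BdrySubcomplex} (c : Choices A) {σ : F → ℝ}

open Classical in
/-- The indicator function of the nodes of a hole. -/
noncomputable def holeIndicator (k : K.Hole) (v : V) : ℝ := if k.HasNode v then 1 else 0

theorem ho_eq [Fintype V] (k : c.HoIndex) : c.ho k = K.δ₀ (holeIndicator k.1) := rfl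

theorem holeIndicator_of_hasNode {k : K.Hole} {v : V} (h : k.HasNode v) :
    holeIndicator k v = 1 := if_pos h

theorem holeIndicator_of_not_hasNode {k : K.Hole} {v : V} (h : ¬ k.HasNode v) :
    holeIndicator k v = 0 := if_neg h

open Classical in
theorem sum_holeIndicator [Fintype c.HoIndex] (b : c.HoIndex → ℝ) {v : V} {k : K.Hole}
    (hv : k.HasNode v) : ∑ i, b i * holeIndicator i.1 v =
      if h : k ≠ c.lastHole ⟨k⟩ then b ⟨k, h⟩ else 0 := by
  have hne : ∀ i : c.HoIndex, i.1 ≠ k → b i * holeIndicator i.1 v = 0 := fun i hi => by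
    rw [holeIndicator_of_not_hasNode fun h => hi (Hole.eq_of_hasNode h hv), mul_zero]
  split_ifs with h
  · rw [Finset.sum_eq_single ⟨k, h⟩ (fun i _ hi => hne i fun h' => hi (Subtype.ext h')) (by simp),
      holeIndicator_of_hasNode hv, mul_one]
  · exact Finset.sum_eq_zero fun i _ => hne i fun h' => h (h' ▸ i.2)

theorem sum_ho_apply [Fintype V] [Fintype c.HoIndex] (b : c.HoIndex → ℝ) (x : E) :
    ∑ k, b k * c.ho k x = ∑ k, b k * holeIndicator k.1 (K.head x) -
      ∑ k, b k * holeIndicator k.1 (K.tail x) := by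
  rw [← Finset.sum_sub_distrib]
  exact Finset.sum_congr rfl fun k _ => by rw [ho_eq, δ₀_apply, mul_sub]

theorem contactEdge_ne_of_ne {i j : Contact A} (h : i ≠ j) :
    (c.contactEdge i).1 ≠ (c.contactEdge j).1 :=
  fun h' => h (c.contactEdge_injective (Subtype.ext h'))

theorem not_mem_dual_of_mem_bdry {x : E} (hx : x ∈ K.bdryEdges) : x ∉ c.dualTreeEdges :=
  fun h => c.not_mem_bdryEdges h hx

theorem not_mem_EM_of_mem_bdry {x : E} (hx : x ∈ K.bdryEdges) : x ∉ c.EM :=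
  fun h => Trees.not_mem_bdry_of_mem_EM h hx

theorem co_bdry_eq_zero [Fintype E] (hσ : K.IsCoherent c.dualTreeEdges σ)
    (hK : K.IsConnectedSurface) (j : c.CoIndex) {x : E} (hx : x ∈ K.bdryEdges)
    (hxj : x ≠ (c.contactEdge j.1).1) (hxl : x ≠ (c.contactEdge (c.lastContact ⟨j.1⟩)).1) :
    c.co j x = 0 :=
  c.co_off hσ hK j (c.not_mem_dual_of_mem_bdry hx) (c.not_mem_EM_of_mem_bdry hx) hxj hxl

theorem ha_apply_ne [Fintype E] (hσ : K.IsCoherent c.dualTreeEdges σ)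
    (hK : K.IsConnectedSurface) {i i' : c.HaIndex} (h : i' ≠ i) : c.ha i' i.1 = 0 :=
  c.ha_off hσ hK i' (Trees.not_mem_dual_of_mem_EM i.2.1) (fun h' => h (Subtype.ext h'.symm)) i.2.2

/-! ### Independence -/

/-- A combination of contact generators that agrees on `∂K` with a relative coboundary is
trivial. -/
theorem co_coeff_eq_zero [Fintype V] [Fintype E] [Fintype F] [Fintype c.CoIndex]
    (hσ : K.IsCoherent c.dualTreeEdges σ) (hK : K.IsConnectedSurface)
    {d : c.CoIndex → ℝ} {u : V → ℝ} (hu : ∀ v ∈ A.nodes, u v = 0)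
    (h : ∀ x ∈ K.bdryEdges, ∑ j, d j * c.co j x = K.δ₀ u x) : d = 0 := by
  -- All contact generators vanish on the unselected edges of contact `k`, so `eq_ends_of_contact`
  -- forces the combination to vanish on the selected edge as well.
  have hzero : ∀ k, ∑ j, d j * c.co j (c.contactEdge k).1 = 0 := by
    intro k
    rw [h _ (c.contactEdge k).2.1, δ₀_apply, sub_eq_zero]
    refine (hK.eq_ends_of_contact (c.contactEdge k) hu fun x hx hr => ?_).symm
    have hxk : (contactGraph A).connectedComponentMk x = k := by
      rw [← c.contactEdge_mem k]
      exact SimpleGraph.ConnectedComponent.sound hr.symm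
    have hne : ∀ j, x.1 ≠ (c.contactEdge j).1 := by
      intro j hj
      have hj' : x = c.contactEdge j := Subtype.ext hj
      refine hx (hj'.trans (congrArg _ ?_))
      rw [← c.contactEdge_mem j, ← hj', hxk]
    have h0 := h x.1 x.2.1
    rw [Finset.sum_eq_zero fun j _ => by
      rw [c.co_bdry_eq_zero hσ hK j x.2.1 (hne _) (hne _), mul_zero], δ₀_apply] at h0
    linarith
  have hnl : ∀ j : c.CoIndex, j.1 ≠ c.lastContact ⟨j.1⟩ → d j = 0 := by
    intro j hj
    have h0 := hzero j.1
    rwa [Finset.sum_eq_single j _ (by simp), c.co_self hσ hK j hj, mul_one] at h0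
    intro i _ hi
    rw [c.co_bdry_eq_zero hσ hK i (c.contactEdge _).2.1
      (c.contactEdge_ne_of_ne fun h' => hi (Subtype.ext h'.symm)) (c.contactEdge_ne_of_ne hj),
      mul_zero]
  funext j
  by_cases hj : j.1 ≠ c.lastContact ⟨j.1⟩
  · exact hnl j hj
  · rw [not_not] at hj
    have h0 := hzero j.1
    -- All generators may meet the distinguished edge, so its equation is read last, when the other
    -- coefficients are known to vanish.
    rw [Finset.sum_eq_single j _ (by simp), c.co_last hσ hK j hj] at h0
    · simpa using h0
    · intro i _ hi
      rw [hnl i, zero_mul]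
      intro hi'
      exact hi (Subtype.ext (hi'.trans hj.symm))

/-- The coefficients of a combination of generators that is a relative coboundary. -/
theorem coeff_eq_zero [Fintype V] [Fintype E] [Fintype F] [Fintype c.HaIndex]
    [Fintype c.HoIndex] [Fintype c.CoIndex]
    (hσ : K.IsCoherent c.dualTreeEdges σ) (hK : K.IsConnectedSurface)
    {a : c.HaIndex → ℝ} {b : c.HoIndex → ℝ} {d : c.CoIndex → ℝ} {u : V → ℝ}
    (hu : ∀ v ∈ A.nodes, u v = 0)
    (h : ∑ i, a i • c.ha i + ∑ k, b k • c.ho k + ∑ j, d j • c.co j = K.δ₀ u) :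
    a = 0 ∧ d = 0 ∧ ∃ r, ∀ v, u v = ∑ k, b k * holeIndicator k.1 v + r := by
  have hx : ∀ x, ∑ i, a i * c.ha i x + ∑ k, b k * c.ho k x + ∑ j, d j * c.co j x =
      K.δ₀ u x := by
    intro x
    rw [← h]
    simp [Finset.sum_apply]
  have hd : d = 0 := by
    refine c.co_coeff_eq_zero hσ hK hu fun x hxb => ?_
    have h1 : ∑ i, a i * c.ha i x = 0 := Finset.sum_eq_zero fun i _ => by
      rw [c.ha_eq_zero hσ hK i (c.not_mem_dual_of_mem_bdry hxb) (c.not_mem_EM_of_mem_bdry hxb),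
        mul_zero]
    have h2 : ∑ k, b k * c.ho k x = 0 := Finset.sum_eq_zero fun k _ => by
      rw [c.ho_bdry k hxb, mul_zero]
    rw [← hx x, h1, h2, add_zero, zero_add]
  subst hd
  have hu' : ∀ x, K.δ₀ (fun v => u v - ∑ k, b k * holeIndicator k.1 v) x =
      ∑ i, a i * c.ha i x := by
    intro x
    have h1 := hx x
    simp only [Pi.zero_apply, zero_mul, Finset.sum_const_zero, add_zero] at h1
    have h2 := c.sum_ho_apply b x
    rw [δ₀_apply] at h1 ⊢
    linarith
  -- Handle generators vanish on the spanning tree, so the potential without its hole part is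
  -- constant and the handle combination is zero as a cochain.
  obtain ⟨r, hr⟩ := hK.eq_const_of_tree c.toTrees
    (u := fun v => u v - ∑ k, b k * holeIndicator k.1 v) fun x hxT => by
      rw [hu']
      exact Finset.sum_eq_zero fun i _ => by
        rw [c.ha_eq_zero hσ hK i (fun h => c.not_mem_treeEdges h hxT) (fun h => h.1 hxT),
          mul_zero]
  refine ⟨?_, rfl, r, fun v => by have := hr v; linarith⟩
  funext i
  have h1 := hu' i.1
  rw [δ₀_apply, hr, hr, sub_self, Finset.sum_eq_single i (fun i' _ hi' => by
    rw [c.ha_apply_ne hσ hK hi', mul_zero]) (by simp), c.ha_self hσ hK, mul_one] at h1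
  exact h1.symm

/-! ### Generation -/

/-- The cochains whose classes are combinations of those of the generators. -/
noncomputable def generated [Fintype V] : Submodule ℝ (E → ℝ) :=
  Submodule.span ℝ (Set.range c.ha) ⊔ Submodule.span ℝ (Set.range c.ho) ⊔
    Submodule.span ℝ (Set.range c.co) ⊔ B1 A

theorem ha_mem_generated [Fintype V] (i : c.HaIndex) : c.ha i ∈ c.generated :=
  Submodule.mem_sup_left (Submodule.mem_sup_left (Submodule.mem_sup_left
    (Submodule.subset_span ⟨i, rfl⟩)))

theorem ho_mem_generated [Fintype V] (k : c.HoIndex) : c.ho k ∈ c.generated :=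
  Submodule.mem_sup_left (Submodule.mem_sup_left (Submodule.mem_sup_right
    (Submodule.subset_span ⟨k, rfl⟩)))

theorem co_mem_generated [Fintype V] (j : c.CoIndex) : c.co j ∈ c.generated :=
  Submodule.mem_sup_left (Submodule.mem_sup_right (Submodule.subset_span ⟨j, rfl⟩))

theorem δ₀_mem_generated [Fintype V] {u : V → ℝ} (hu : ∀ v ∈ A.nodes, u v = 0) :
    K.δ₀ u ∈ c.generated :=
  Submodule.mem_sup_right ⟨u, hu, rfl⟩

/-- A cocycle that vanishes on `∂K` and on the spanning tree is generated by the handles. -/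
theorem mem_generated_of_tree [Fintype V] [Fintype E] [Fintype F]
    (hσ : K.IsCoherent c.dualTreeEdges σ) (hK : K.IsConnectedSurface)
    {g : E → ℝ} (hg : g ∈ LinearMap.ker K.δ₁) (hb : ∀ x ∈ K.bdryEdges, g x = 0)
    (hT : ∀ x ∈ c.treeEdges, g x = 0) : g ∈ c.generated := by
  classical
  have := Fintype.ofFinite c.HaIndex
  let s : E → ℝ := ∑ i : c.HaIndex, g i.1 • c.ha i
  have hs : s ∈ c.generated :=
    Submodule.sum_mem _ fun i _ => Submodule.smul_mem _ _ (c.ha_mem_generated i)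
  have hsk : s ∈ LinearMap.ker K.δ₁ :=
    Submodule.sum_mem _ fun i _ => Submodule.smul_mem _ _ (c.ha_mem_ker hσ hK i)
  have hsx : ∀ x, s x = ∑ i : c.HaIndex, g i.1 * c.ha i x := fun x => by simp [s]
  have hker : g - s ∈ LinearMap.ker K.δ₁ := Submodule.sub_mem _ hg hsk
  have hoff : ∀ y, y ∉ c.dualTreeEdges → (∀ h, y ≠ c.star h) → (g - s) y = 0 := by
    intro y hyD hys
    rw [Pi.sub_apply, hsx]
    by_cases hyM : y ∈ c.EM
    · rw [Finset.sum_eq_single ⟨y, hyM, hys⟩ (fun i _ hi => by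
        rw [c.ha_off hσ hK i hyD (fun h => hi (Subtype.ext h.symm)) hys, mul_zero]) (by simp),
        c.ha_self hσ hK ⟨y, hyM, hys⟩, mul_one, sub_self]
    · rw [Finset.sum_eq_zero fun i _ => by rw [c.ha_eq_zero hσ hK i hyD hyM, mul_zero], sub_zero]
      by_cases hyT : y ∈ c.treeEdges
      · exact hT y hyT
      · by_contra h0
        exact hyM (Trees.mem_EM_of_not_mem hyT hyD fun h => h0 (hb y h))
  have hzero : g - s = 0 := by
    refine Trees.eq_zero_of_support_dual hσ hK hker fun y hyD => ?_
    by_cases hys : ∀ h, y ≠ c.star h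
    · exact hoff y hyD hys
    push Not at hys
    obtain ⟨hne, rfl⟩ := hys
    -- Off the dual tree, only the selected edge of `EMII` can still carry a value, and its weight
    -- in the relation is non-zero.
    have hsum := sum_sum_eps_mul σ hker
    rw [Finset.sum_eq_single (c.star hne)] at hsum
    · exact (mul_eq_zero.1 hsum).resolve_left
        (Trees.sum_eps_EMII_ne_zero hσ hK (c.star_mem hne))
    · intro z _ hz
      by_cases hzD : z ∈ c.dualTreeEdges
      · rw [Trees.sum_eps_dual hσ hK hzD, zero_mul]
      · rw [hoff z hzD fun _ => hz, mul_zero]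
    · simp
  rw [sub_eq_zero.1 hzero]
  exact hs

/-- A cocycle that vanishes on `∂K` is generated by the handles and the holes. -/
theorem mem_generated_of_bdry [Fintype V] [Fintype E] [Fintype F]
    (hσ : K.IsCoherent c.dualTreeEdges σ) (hK : K.IsConnectedSurface)
    {g : E → ℝ} (hg : g ∈ LinearMap.ker K.δ₁) (hb : ∀ x ∈ K.bdryEdges, g x = 0) :
    g ∈ c.generated := by
  classical
  have := Fintype.ofFinite c.HoIndex
  obtain ⟨u, hu⟩ := Trees.exists_δ₀_eq_on_tree c.toTrees g
  have hhole : ∀ {k : K.Hole} {v w : V}, k.HasNode v → k.HasNode w → u v = u w := by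
    intro k v w hv hw
    refine eq_of_edgeGraph_reachable (fun x hx => ?_) (c.tree_bdry v w (Hole.reachable hv hw))
    have := hu x hx.1
    rw [hb x hx.2, δ₀_apply] at this
    linarith
  choose nd hnd using fun k : K.Hole => k.exists_node
  -- Shifting by the value on the omitted hole lets the hole generators correct the other holes, so
  -- that `u₀` vanishes on all boundary nodes. Without holes the shift is irrelevant.
  let r : ℝ := if h : Nonempty K.Hole then u (nd (c.lastHole h)) else 0
  let b : c.HoIndex → ℝ := fun k => u (nd k.1) - r
  let u₀ : V → ℝ := fun v => u v - r - ∑ k, b k * holeIndicator k.1 v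
  have hu₀ : ∀ v ∈ A.nodes, u₀ v = 0 := by
    intro v hv
    obtain ⟨k, hk⟩ := Hole.exists_hasNode (A.nodes_subset hv)
    simp only [u₀]
    rw [c.sum_holeIndicator b hk]
    split_ifs with h
    · simp only [b]
      rw [hhole hk (hnd k)]
      ring
    · rw [not_not] at h
      have : r = u (nd (c.lastHole ⟨k⟩)) := dif_pos ⟨k⟩
      rw [this, ← h, hhole hk (hnd k)]
      ring
  have hδ : K.δ₀ u = K.δ₀ u₀ + ∑ k, b k • c.ho k := by
    funext x
    have h2 := c.sum_ho_apply b x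
    simp only [Pi.add_apply, Finset.sum_apply, Pi.smul_apply, smul_eq_mul]
    rw [h2, δ₀_apply, δ₀_apply]
    simp only [u₀]
    ring
  have hδm : K.δ₀ u ∈ c.generated := by
    rw [hδ]
    exact Submodule.add_mem _ (c.δ₀_mem_generated hu₀)
      (Submodule.sum_mem _ fun k _ => Submodule.smul_mem _ _ (c.ho_mem_generated k))
  have hrest : g - K.δ₀ u ∈ c.generated := by
    refine c.mem_generated_of_tree hσ hK
      (Submodule.sub_mem _ hg (LinearMap.mem_ker.2 (δ₁_δ₀ u))) (fun x hx => ?_) fun x hx => ?_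
    · obtain ⟨k, hk⟩ := Hole.exists_hasNode (K := K) ⟨x, hx, isEnd_tail x⟩
      rw [Pi.sub_apply, hb x hx, δ₀_apply, hhole hk ((k.hasNode_iff_of_mem_bdryEdges hx).1 hk)]
      ring
    · rw [Pi.sub_apply, hu x hx, sub_self]
  have := Submodule.add_mem _ hrest hδm
  rwa [sub_add_cancel] at this

/-- Every relative cocycle is generated. -/
theorem mem_generated [Fintype V] [Fintype E] [Fintype F]
    (hσ : K.IsCoherent c.dualTreeEdges σ) (hK : K.IsConnectedSurface)
    {g : E → ℝ} (hg : g ∈ Z1 A) : g ∈ c.generated := by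
  classical
  have := Fintype.ofFinite c.CoIndex
  obtain ⟨u, hu, hug⟩ := hK.exists_eq_δ₀_on_bdry c.contactEdge c.contactEdge_mem hg.1
  suffices h : g - K.δ₀ u ∈ c.generated by
    have := Submodule.add_mem _ h (c.δ₀_mem_generated hu)
    rwa [sub_add_cancel] at this
  have hker : g - K.δ₀ u ∈ LinearMap.ker K.δ₁ :=
    Submodule.sub_mem _ hg.2 (LinearMap.mem_ker.2 (δ₁_δ₀ u))
  have hoff : ∀ x ∈ K.bdryEdges, (∀ j, x ≠ (c.contactEdge j).1) → (g - K.δ₀ u) x = 0 := by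
    intro x hx hxj
    rw [Pi.sub_apply, hug x hx hxj, sub_self]
  generalize g - K.δ₀ u = g₁ at hker hoff
  by_cases hne : Nonempty (Contact A)
  swap
  · exact c.mem_generated_of_bdry hσ hK hker fun x hx => hoff x hx fun j => (hne ⟨j⟩).elim
  let l := c.lastContact hne
  -- The distinguished contact gets coefficient `0` here; its edge also receives contributions from
  -- the other generators and is cleared afterwards.
  let s : E → ℝ := ∑ j : c.CoIndex, (if j.1 = l then 0 else g₁ (c.contactEdge j.1).1) • c.co j
  have hs : s ∈ c.generated :=
    Submodule.sum_mem _ fun j _ => Submodule.smul_mem _ _ (c.co_mem_generated j)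
  have hsk : s ∈ LinearMap.ker K.δ₁ :=
    Submodule.sum_mem _ fun j _ => Submodule.smul_mem _ _ (c.co_mem_ker hσ hK j)
  have hsx : ∀ x, s x = ∑ j : c.CoIndex, (if j.1 = l then 0 else g₁ (c.contactEdge j.1).1) *
      c.co j x := fun x => by
    simp only [s, Finset.sum_apply, Pi.smul_apply, smul_eq_mul]
  suffices h : g₁ - s ∈ c.generated by
    have := Submodule.add_mem _ h hs
    rwa [sub_add_cancel] at this
  have hker₂ : g₁ - s ∈ LinearMap.ker K.δ₁ := Submodule.sub_mem _ hker hsk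
  have hoff₂ : ∀ x ∈ K.bdryEdges, x ≠ (c.contactEdge l).1 → (g₁ - s) x = 0 := by
    intro x hx hxl
    rw [Pi.sub_apply, hsx]
    by_cases hxj : ∀ j, x ≠ (c.contactEdge j).1
    · rw [hoff x hx hxj, Finset.sum_eq_zero fun j _ => by
        rw [c.co_bdry_eq_zero hσ hK j hx (hxj _) hxl, mul_zero], sub_zero]
    · push Not at hxj
      obtain ⟨j, rfl⟩ := hxj
      have hjl : j ≠ l := by rintro rfl; exact hxl rfl
      rw [Finset.sum_eq_single (⟨j, Or.inr hjl⟩ : c.CoIndex) (fun i _ hi => by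
        rw [c.co_bdry_eq_zero hσ hK i hx
          (c.contactEdge_ne_of_ne fun h' => hi (Subtype.ext h'.symm)) hxl, mul_zero]) (by simp),
        if_neg hjl, c.co_self hσ hK ⟨j, Or.inr hjl⟩ hjl, mul_one, sub_self]
  generalize g₁ - s = g₂ at hker₂ hoff₂
  have hlb := (c.contactEdge l).2.1
  by_cases hII : c.EMII.Nonempty
  · let jl : c.CoIndex := ⟨l, Or.inl hII⟩
    -- The division compensates the value `2` of the additional contact generator on its boundary
    -- edge.
    let g₃ : E → ℝ := (g₂ (c.contactEdge l).1 / 2) • c.co jl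
    have hg₃ : g₃ ∈ c.generated := Submodule.smul_mem _ _ (c.co_mem_generated jl)
    have hg₃k : g₃ ∈ LinearMap.ker K.δ₁ := Submodule.smul_mem _ _ (c.co_mem_ker hσ hK jl)
    have : g₂ - g₃ ∈ c.generated := by
      refine c.mem_generated_of_bdry hσ hK (Submodule.sub_mem _ hker₂ hg₃k) fun x hx => ?_
      rw [Pi.sub_apply, show g₃ x = g₂ (c.contactEdge l).1 / 2 * c.co jl x from rfl]
      by_cases hxl : x = (c.contactEdge l).1
      · rw [hxl, c.co_last hσ hK jl rfl]
        ring
      · rw [hoff₂ x hx hxl, c.co_bdry_eq_zero hσ hK jl hx hxl hxl, mul_zero, sub_zero]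
    have := Submodule.add_mem _ this hg₃
    rwa [sub_add_cancel] at this
  · refine c.mem_generated_of_bdry hσ hK hker₂ fun x hx => ?_
    by_cases hxl : x = (c.contactEdge l).1
    swap
    · exact hoff₂ x hx hxl
    subst hxl
    -- With `EMII` empty no interior edge has weight, so the relation involves the distinguished
    -- edge alone.
    have hsum := sum_sum_eps_mul σ hker₂
    rw [Finset.sum_eq_single (c.contactEdge l).1] at hsum
    · exact (mul_eq_zero.1 hsum).resolve_left (Trees.sum_eps_bdry_ne_zero hσ hlb)
    · intro z _ hz
      by_cases hzb : z ∈ K.bdryEdges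
      · rw [hoff₂ z hzb hz, mul_zero]
      · rw [Trees.sum_eps_eq_zero_of_EMII_empty hσ hK hII hzb, zero_mul]
    · simp

end Choices

/-! ### Cohomology classes -/

variable {A : K.BdrySubcomplex}

theorem cls_eq_zero_iff [Fintype V] [Fintype E] {g : E → ℝ} (hg : g ∈ Z1 A) : cls A g hg = 0 ↔ g ∈ B1 A := by
  rw [cls, Submodule.mkQ_apply, Submodule.Quotient.mk_eq_zero]
  rfl

theorem cls_add [Fintype V] [Fintype E] {g h : E → ℝ} (hg : g ∈ Z1 A) (hh : h ∈ Z1 A) :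
    cls A (g + h) (Submodule.add_mem _ hg hh) = cls A g hg + cls A h hh :=
  map_add ((B1 A).submoduleOf (Z1 A)).mkQ ⟨g, hg⟩ ⟨h, hh⟩

theorem sum_smul_mem_Z1 [Fintype E] {I : Type*} [Fintype I] {g : I → E → ℝ} (hg : ∀ i, g i ∈ Z1 A)
    (a : I → ℝ) : ∑ i, a i • g i ∈ Z1 A :=
  Submodule.sum_mem _ fun i _ => Submodule.smul_mem _ _ (hg i)

theorem cls_sum_smul [Fintype V] [Fintype E] {I : Type*} [Fintype I]
    {g : I → E → ℝ} (hg : ∀ i, g i ∈ Z1 A)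
    (a : I → ℝ) :
    cls A (∑ i, a i • g i) (sum_smul_mem_Z1 hg a) = ∑ i, a i • cls A (g i) (hg i) := by
  simp only [cls, ← map_smul, ← map_sum]
  congr 1
  refine Subtype.ext ?_
  simp

theorem cls_mem_clsSpan [Fintype V] [Fintype E] {I : Type*} [Fintype I]
    {g : I → E → ℝ} (hg : ∀ i, g i ∈ Z1 A)
    {x : E → ℝ} (hx : x ∈ Submodule.span ℝ (Set.range g)) :
    ∃ h : x ∈ Z1 A, cls A x h ∈ clsSpan A g hg := by
  obtain ⟨a, rfl⟩ := (Submodule.mem_span_range_iff_exists_fun ℝ).1 hx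
  refine ⟨sum_smul_mem_Z1 hg a, ?_⟩
  rw [cls_sum_smul hg]
  exact (Submodule.mem_span_range_iff_exists_fun ℝ).2 ⟨a, rfl⟩

theorem isInternal_of_three {M : Type*} [AddCommGroup M] [Module ℝ M] {p q r : Submodule ℝ M}
    (hind : ∀ x ∈ p, ∀ y ∈ q, ∀ z ∈ r, x + y + z = 0 → x = 0 ∧ y = 0 ∧ z = 0)
    (htop : p ⊔ q ⊔ r = ⊤) : DirectSum.IsInternal ![p, q, r] := by
  refine DirectSum.isInternal_submodule_of_iSupIndep_of_iSup_eq_top ?_ ?_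
  · rw [iSupIndep_iff_finsetSum_eq_zero_imp_eq_zero]
    intro s v hv hsum
    let w : Fin 3 → M := fun i => if i ∈ s then v i else 0
    have hw : ∀ i, w i ∈ (![p, q, r] : Fin 3 → Submodule ℝ M) i := by
      intro i
      simp only [w]
      split_ifs with h
      · exact hv i h
      · exact Submodule.zero_mem _
    have hsum' : w 0 + w 1 + w 2 = 0 := by
      rw [← Fin.sum_univ_three, ← hsum]
      simp [w]
    obtain ⟨h0, h1, h2⟩ := hind _ (hw 0) _ (hw 1) _ (hw 2) hsum'
    intro i hi
    have hwi : w i = v i := if_pos hi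
    rw [← hwi]
    fin_cases i
    · exact h0
    · exact h1
    · exact h2
  · rw [eq_top_iff, ← htop]
    exact sup_le (sup_le (le_iSup (![p, q, r] : Fin 3 → Submodule ℝ M) 0)
      (le_iSup (![p, q, r] : Fin 3 → Submodule ℝ M) 1))
      (le_iSup (![p, q, r] : Fin 3 → Submodule ℝ M) 2)

namespace Choices

variable (c : Choices A) {σ : F → ℝ}

theorem cls_coeff_eq_zero [Fintype V] [Fintype E] [Fintype F] [Fintype c.HaIndex]
    [Fintype c.HoIndex] [Fintype c.CoIndex] (hσ : K.IsCoherent c.dualTreeEdges σ)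
    (hK : K.IsConnectedSurface) (hha : ∀ i, c.ha i ∈ Z1 A) (hho : ∀ i, c.ho i ∈ Z1 A)
    (hco : ∀ i, c.co i ∈ Z1 A) {a : c.HaIndex → ℝ} {b : c.HoIndex → ℝ} {d : c.CoIndex → ℝ}
    (h : ∑ i, a i • cls A (c.ha i) (hha i) + ∑ i, b i • cls A (c.ho i) (hho i) +
      ∑ i, d i • cls A (c.co i) (hco i) = 0) :
    a = 0 ∧ d = 0 ∧ ∃ r, ∀ v ∈ A.nodes, ∑ k, b k * holeIndicator k.1 v + r = 0 := by
  rw [← cls_sum_smul, ← cls_sum_smul, ← cls_sum_smul, ← cls_add, ← cls_add, cls_eq_zero_iff] at h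
  obtain ⟨u, hu, huδ⟩ := h
  obtain ⟨ha, hd, r, hr⟩ := c.coeff_eq_zero hσ hK hu huδ.symm
  exact ⟨ha, hd, r, fun v hv => (hr v).symm.trans (hu v hv)⟩

/-- The constant `r` is lost under `δ₀` but can make the potential vanish on `A`. With
`cls_coeff_eq_zero` this describes exactly the relations among hole classes. -/
theorem sum_cls_ho_eq_zero [Fintype V] [Fintype E] [Fintype c.HoIndex]
    (hho : ∀ i, c.ho i ∈ Z1 A) {b : c.HoIndex → ℝ} {r : ℝ}
    (h : ∀ v ∈ A.nodes, ∑ k, b k * holeIndicator k.1 v + r = 0) :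
    ∑ i, b i • cls A (c.ho i) (hho i) = 0 := by
  rw [← cls_sum_smul, cls_eq_zero_iff]
  refine ⟨fun v => ∑ k, b k * holeIndicator k.1 v + r, h, ?_⟩
  funext x
  simp only [Finset.sum_apply, Pi.smul_apply, smul_eq_mul]
  rw [δ₀_apply, c.sum_ho_apply]
  ring

theorem clsSpan_sup_eq_top [Fintype V] [Fintype E] [Fintype F]
    (hσ : K.IsCoherent c.dualTreeEdges σ)
    (hK : K.IsConnectedSurface) (hha : ∀ i, c.ha i ∈ Z1 A) (hho : ∀ i, c.ho i ∈ Z1 A)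
    (hco : ∀ i, c.co i ∈ Z1 A) :
    clsSpan A c.ha hha ⊔ clsSpan A c.ho hho ⊔ clsSpan A c.co hco = ⊤ := by
  classical
  have := Fintype.ofFinite c.HaIndex
  have := Fintype.ofFinite c.HoIndex
  have := Fintype.ofFinite c.CoIndex
  rw [eq_top_iff]
  rintro y -
  obtain ⟨⟨g, hg⟩, rfl⟩ := Submodule.mkQ_surjective _ y
  change cls A g hg ∈ _
  obtain ⟨w, hw, z, hz, rfl⟩ := Submodule.mem_sup.1 (c.mem_generated hσ hK hg)
  obtain ⟨w', hw', x₃, hx₃, rfl⟩ := Submodule.mem_sup.1 hw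
  obtain ⟨x₁, hx₁, x₂, hx₂, rfl⟩ := Submodule.mem_sup.1 hw'
  obtain ⟨h1, hc1⟩ := cls_mem_clsSpan hha hx₁
  obtain ⟨h2, hc2⟩ := cls_mem_clsSpan hho hx₂
  obtain ⟨h3, hc3⟩ := cls_mem_clsSpan hco hx₃
  have h12 := Submodule.add_mem _ h1 h2
  have h123 := Submodule.add_mem _ h12 h3
  have hz' : z ∈ Z1 A := by
    have := Submodule.sub_mem _ hg h123
    rwa [add_sub_cancel_left] at this
  rw [cls_add h123 hz', cls_add h12 h3, cls_add h1 h2, (cls_eq_zero_iff hz').2 hz, add_zero]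
  exact Submodule.add_mem _ (Submodule.mem_sup_left (Submodule.add_mem _
    (Submodule.mem_sup_left hc1) (Submodule.mem_sup_right hc2))) (Submodule.mem_sup_right hc3)

theorem span_all_eq_top [Fintype V] [Fintype E] [Fintype F] (hσ : K.IsCoherent c.dualTreeEdges σ)
    (hK : K.IsConnectedSurface) (hall : ∀ i, c.all i ∈ Z1 A) :
    Submodule.span ℝ (Set.range fun i => cls A (c.all i) (hall i)) = ⊤ := by
  rw [eq_top_iff, ← c.clsSpan_sup_eq_top hσ hK (fun i => hall (Sum.inl i))
    (fun i => hall (Sum.inr (Sum.inl i))) (fun i => hall (Sum.inr (Sum.inr i)))]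
  refine sup_le (sup_le ?_ ?_) ?_ <;> refine Submodule.span_mono ?_
  · rintro _ ⟨i, rfl⟩
    exact ⟨Sum.inl i, rfl⟩
  · rintro _ ⟨i, rfl⟩
    exact ⟨Sum.inr (Sum.inl i), rfl⟩
  · rintro _ ⟨i, rfl⟩
    exact ⟨Sum.inr (Sum.inr i), rfl⟩

/-- If a hole misses `A`, then its own generator is a relative coboundary, or, when it is the
omitted hole, all hole generators add up to one. If every hole meets `A`, a node of `A` in the
omitted hole gives `r = 0`, and one in hole `k` then gives `b k = 0`. With at most one hole there
are no hole generators. -/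
theorem linearIndependent_all_iff [Fintype V] [Fintype E] [Fintype F]
    (hσ : K.IsCoherent c.dualTreeEdges σ) (hK : K.IsConnectedSurface)
    (hall : ∀ i, c.all i ∈ Z1 A) :
    LinearIndependent ℝ (fun i => cls A (c.all i) (hall i)) ↔
      (∀ k : K.Hole, ∃ v ∈ A.nodes, k.HasNode v) ∨ Subsingleton K.Hole := by
  classical
  have := Fintype.ofFinite c.HaIndex
  have := Fintype.ofFinite c.HoIndex
  have := Fintype.ofFinite c.CoIndex
  constructor
  · intro h
    by_contra hne
    rw [not_or] at hne
    obtain ⟨h1, h2⟩ := hne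
    push Not at h1
    obtain ⟨k₀, hk₀⟩ := h1
    have hho : LinearIndependent ℝ fun k : c.HoIndex =>
        cls A (c.ho k) (hall (Sum.inr (Sum.inl k))) :=
      h.comp (fun k => Sum.inr (Sum.inl k)) (Sum.inr_injective.comp Sum.inl_injective)
    rw [Fintype.linearIndependent_iff] at hho
    by_cases hlast : k₀ = c.lastHole ⟨k₀⟩
    · have hex : ∃ k : K.Hole, k ≠ c.lastHole ⟨k⟩ := by
        by_contra hall'
        push Not at hall'
        exact h2 ⟨fun k k' => (hall' k).trans (hall' k').symm⟩
      obtain ⟨k, hk⟩ := hex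
      -- All nodes of `A` lie in holes other than the omitted one, where the indicators sum to `1`;
      -- `-1` cancels this.
      have := hho (fun _ => 1) (c.sum_cls_ho_eq_zero _ (r := -1) fun v hv => by
        obtain ⟨k', hk'⟩ := Hole.exists_hasNode (A.nodes_subset hv)
        have hne : k' ≠ c.lastHole ⟨k'⟩ := by
          intro h'
          exact hk₀ v hv (by rwa [hlast, ← h'])
        rw [c.sum_holeIndicator _ hk', dif_pos hne]
        norm_num) ⟨k, hk⟩
      exact one_ne_zero this
    · have := hho (Pi.single ⟨k₀, hlast⟩ 1) (c.sum_cls_ho_eq_zero _ (r := 0) fun v hv => by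
        obtain ⟨k', hk'⟩ := Hole.exists_hasNode (A.nodes_subset hv)
        have hne : k' ≠ k₀ := by
          rintro rfl
          exact hk₀ v hv hk'
        rw [c.sum_holeIndicator _ hk', add_zero]
        split_ifs with h'
        · rw [Pi.single_apply, if_neg fun h'' => hne (congrArg Subtype.val h'')]
        · rfl) ⟨k₀, hlast⟩
      rw [Pi.single_eq_same] at this
      exact one_ne_zero this
  · intro hcond
    rw [Fintype.linearIndependent_iff]
    intro a ha
    rw [Fintype.sum_sum_type, Fintype.sum_sum_type, ← add_assoc] at ha
    obtain ⟨h1, h2, r, hr⟩ := c.cls_coeff_eq_zero hσ hK (fun i => hall (Sum.inl i))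
      (fun i => hall (Sum.inr (Sum.inl i))) (fun i => hall (Sum.inr (Sum.inr i)))
      (a := fun i => a (Sum.inl i)) (b := fun i => a (Sum.inr (Sum.inl i)))
      (d := fun i => a (Sum.inr (Sum.inr i))) ha
    rintro (i | k | j)
    · exact congrFun h1 i
    · rcases hcond with hcond | hcond
      · obtain ⟨v, hv, hvl⟩ := hcond (c.lastHole ⟨k.1⟩)
        obtain ⟨w, hw, hwk⟩ := hcond k.1
        have e1 := hr v hv
        have e2 := hr w hw
        rw [c.sum_holeIndicator _ hvl, dif_neg (not_not.2 rfl), zero_add] at e1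
        rw [c.sum_holeIndicator _ hwk, dif_pos k.2, e1, add_zero] at e2
        exact e2
      · exact (k.2 (Subsingleton.elim _ _)).elim
    · exact congrFun h2 j

end Choices

end Triangulation

theorem mainTheorem1 {V E F : Type*} [Fintype V] [Fintype E] [Fintype F]
    (K : Triangulation V E F) (hK : K.IsConnectedSurface) (A : K.BdrySubcomplex) :
    Nonempty (Triangulation.Choices A) ∧
    ∀ c : Triangulation.Choices A,
      ∃ (hha : ∀ i, c.ha i ∈ Triangulation.Z1 A) (hho : ∀ i, c.ho i ∈ Triangulation.Z1 A)
        (hco : ∀ i, c.co i ∈ Triangulation.Z1 A) (hall : ∀ i, c.all i ∈ Triangulation.Z1 A),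
        DirectSum.IsInternal
          ![Triangulation.clsSpan A c.ha hha, Triangulation.clsSpan A c.ho hho,
            Triangulation.clsSpan A c.co hco] ∧
        LinearIndependent ℝ (fun i => Triangulation.cls A (c.ha i) (hha i)) ∧
        LinearIndependent ℝ (fun i => Triangulation.cls A (c.co i) (hco i)) ∧
        (LinearIndependent ℝ (fun i => Triangulation.cls A (c.all i) (hall i)) ∧
          Submodule.span ℝ (Set.range fun i => Triangulation.cls A (c.all i) (hall i)) = ⊤ ↔
          (∀ k : K.Hole, ∃ v ∈ A.nodes, k.HasNode v) ∨ Subsingleton K.Hole) := by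
  classical
  refine ⟨Triangulation.nonempty_choices hK A, fun c => ?_⟩
  have := Fintype.ofFinite c.HaIndex
  have := Fintype.ofFinite c.HoIndex
  have := Fintype.ofFinite c.CoIndex
  obtain ⟨σ, hσ⟩ := c.exists_isCoherent hK
  have hha := c.ha_mem_Z1 hσ hK
  have hho := c.ho_mem_Z1
  have hco := c.co_mem_Z1 hσ hK
  have hall : ∀ i, c.all i ∈ Triangulation.Z1 A := by
    rintro (i | k | j)
    · exact hha i
    · exact hho k
    · exact hco j
  refine ⟨hha, hho, hco, hall, ?_, ?_, ?_, ?_⟩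
  · refine Triangulation.isInternal_of_three ?_ (c.clsSpan_sup_eq_top hσ hK hha hho hco)
    intro x hx y hy z hz h
    obtain ⟨a, rfl⟩ := (Submodule.mem_span_range_iff_exists_fun ℝ).1 hx
    obtain ⟨b, rfl⟩ := (Submodule.mem_span_range_iff_exists_fun ℝ).1 hy
    obtain ⟨d, rfl⟩ := (Submodule.mem_span_range_iff_exists_fun ℝ).1 hz
    -- Directness does not need the hole classes to be independent: once the handle and contact
    -- parts are zero, the equation itself says that the hole part is.
    obtain ⟨rfl, rfl, -⟩ := c.cls_coeff_eq_zero hσ hK hha hho hco h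
    simpa using h
  · rw [Fintype.linearIndependent_iff]
    intro a ha
    exact congrFun (c.cls_coeff_eq_zero hσ hK hha hho hco (a := a) (b := 0) (d := 0)
      (by simpa using ha)).1
  · rw [Fintype.linearIndependent_iff]
    intro d hd
    exact congrFun (c.cls_coeff_eq_zero hσ hK hha hho hco (a := 0) (b := 0) (d := d)
      (by simpa using hd)).2.1
  · rw [c.linearIndependent_all_iff hσ hK hall]
    exact and_iff_left (c.span_all_eq_top hσ hK hall)
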